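/- Let $\Sigma$ be a propositional vocabulary and $\mathcal A$ a set of agents. *Prebiworlds.* By transfinite recursion on (countable) ordinals $\mu$, define $\mu$-prebiworlds, their objective interpretation $w^{\mathrm{obj}}$ and their restrictions. A $0$-prebiworld is an interpretation $I\subseteq\Sigma$, and is its own objective interpretation. A $(\mu+1)$-prebiworld is a triple $w=(I,(A^w)_{A\in\mathcal A},(\bar A^w)_{A\in\mathcal A})$ with $w^{\mathrm{obj}}=I\subseteq\Sigma$ and $A^w,\bar A^w$ sets of $\mu$-prebiworlds. For a limit ordinal $\lambda$, a $\lambda$-prebiworld is a sequence $w=((w)_\alpha)_{\alpha<\lambda}$ of $\alpha$-prebiworlds with $(w)_\alpha|_\beta=(w)_\beta$ for $\beta\le\alpha<\lambda$, and $w^{\mathrm{obj}}=(w)_0$. The restriction $w|_\alpha$ of a $\mu$-prebiworld to $\alpha\le\mu$ is: $w^{\mathrm{obj}}$ if $\alpha=0$; $(w|_\beta)_{\beta<\alpha}$ if $\alpha$ is a limit; and if $\alpha=\alpha'+1$, it is $(w)_\alpha$ if $\mu$ is a limit, and the triple with interpretation $w^{\mathrm{obj}}$ and sets $\{x|_{\alpha'}: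 x\in A^w\}$, $\{x|_{\alpha'}: x\in\bar A^w\}$ if $\mu$ is a successor. If $w|_\alpha=x$, then $w$ is said to extend $x$. *Biworlds.* Every $0$-prebiworld is a $0$-biworld, and a prebiworld $w$ of limit depth $\lambda$ is a $\lambda$-biworld iff every $(w)_\alpha$, $\alpha<\lambda$, is an $\alpha$-biworld. Given the $\mu$-biworlds, the set of incompleted $\mu$-prebiworlds and the set of $(\mu+1)$-biworlds are the simultaneously least sets such that (i) a $\mu$-prebiworld is incompleted iff at least two distinct $(\mu+1)$-biworlds extend it, and (ii) a $(\mu+1)$-prebiworld $w$ is a $(\mu+1)$-biworld iff for every agent $A$ the union $A^w\cup\bar A^w$ is the set of all $\mu$-biworlds and every element of $A^w\cap\bar A^w$ is incompleted. A prebiworld is completed if it is not incompleted. *Formulas and three-valued valuation.* Formulas are built from the atoms in $\Sigma$ by $\neg$, $\wedge$, $K_A$, $M_A$ ($A\in\mathcal A$), $E_G$ and $C_G$ ($G\subseteq\mathcal A$). The truth values $\mathbf t,\mathbf f,\mathbf u$ carry the truth order $\mathbf f\le_t\mathbf u\le_t\mathbf t$, the precision order given by $\mathbf u\le_p\mathbf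 t$ and $\mathbf u\le_p\mathbf f$, and the inverse $\mathbf t^{-1}=\mathbf f$, $\mathbf f^{-1}=\mathbf t$, $\mathbf u^{-1}=\mathbf u$. For a $\mu$-biworld $w$: $P^w=\mathbf t$ if $P\in w^{\mathrm{obj}}$, and $P^w=\mathbf f$ otherwise; $(\neg\varphi)^w=(\varphi^w)^{-1}$; $(\varphi\wedge\psi)^w=\mathrm{glb}_{\le_t}\{\varphi^w,\psi^w\}$; if $\mu=0$, then $(K_A\varphi)^w=(M_A\varphi)^w=\mathbf u$; if $\mu$ is a successor, then $(K_A\varphi)^w=\mathrm{glb}_{\le_t}\{\varphi^{x}: x\in A^w\}$ and $(M_A\varphi)^w=\mathrm{glb}_{\le_t}\{(\varphi^{x})^{-1}: x\in\bar A^w\}$; if $\mu$ is a limit, then $(K_A\varphi)^w=\mathrm{lub}_{\le_p}\{(K_A\varphi)^{(w)_\alpha}:\alpha<\mu\}$ and $(M_A\varphi)^w=\mathrm{lub}_{\le_p}\{(M_A\varphi)^{(w)_\alpha}:\alpha<\mu\}$; $(E_G\varphi)^w=\mathrm{glb}_{\le_t}\{(K_A\varphi)^w:A\in G\}$; and $(C_G\varphi)^w=\mathrm{glb}_{\le_t}\{(E_G^k\varphi)^w:k\ge1\}$,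 where $E_G^0\varphi=\varphi$ and $E_G^{k+1}\varphi=E_G(E_G^k\varphi)$. *Canonical Kripke structure.* Let $\mathcal K^*=(U,(R_A)_{A\in\mathcal A})$, where $U$ is the set of all completed $(\omega^2+1)$-biworlds and, for $w,w'\in U$, $w\,R_A\,w'$ iff $w'|_{\omega^2}\in A^w$. For $w\in U$ let $\varphi^{\mathcal K^*,w}\in\{\mathbf t,\mathbf f\}$ be the usual Kripke value: an atom $P$ is true at $w$ iff $P\in w^{\mathrm{obj}}$; $\neg,\wedge$ are classical; $K_A\varphi$ is true at $w$ iff $\varphi$ is true at every $w'\in U$ with $w\,R_A\,w'$; $M_A\varphi$ is true at $w$ iff $w\,R_A\,w'$ for every $w'\in U$ at which $\varphi$ is true; $E_G\varphi$ is true at $w$ iff $K_A\varphi$ is true at $w$ for all $A\in G$; and $C_G\varphi$ is true at $w$ iff $\varphi$ is true at every world reachable from $w$ by one or more steps along $\bigcup_{A\in G}R_A$. **Theorem.** For every formula $\varphi$ and every $w\in U$, $\varphi^w=\varphi^{\mathcal K^*,w}$. That is, on completed $(\omega^2+1)$-biworlds the three-valued valuation coincides with the two-valued Kripke valuation on $\mathcal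 K^*$. -/

import Mathlib

noncomputable section

namespace Biworlds

open Ordinal Order

universe u v

/-! ### Ordinal bookkeeping -/

theorem not_add_one_le_zero {α : Ordinal.{0}} : ¬ α + 1 ≤ 0 := by
  simp

theorem zero_lt_of_limit {μ : Ordinal.{0}} (hμ : IsSuccLimit μ) : 0 < μ := by
  simpa using hμ.bot_lt

theorem add_one_lt_of_limit {α μ : Ordinal.{0}} (hμ : IsSuccLimit μ) (h : α < μ) :
    α + 1 < μ := by
  simpa using hμ.succ_lt h

theorem lt_of_add_one_le {α μ : Ordinal.{0}} (h : α + 1 ≤ μ) : α < μ := by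
  simpa using h

theorem le_of_add_one_le_add_one {α μ : Ordinal.{0}} (h : α + 1 ≤ μ + 1) : α ≤ μ := by
  simpa using h

/-! ### Prebiworlds

`V` is the propositional vocabulary and `Ag` the set of agents; an interpretation is the set of
the atoms that are true in it.  `Raw V Ag μ` is the type of the hereditary objects of depth `μ`:
interpretations for `μ = 0`, triples `(I, (A^w)_A, (Abar^w)_A)` for a successor `μ`, and
sequences indexed by the ordinals below `μ` for a limit `μ`.  The requirement that the sequences
at limit depths are increasing in the precision order needs restrictions; it is imposed
(hereditarily) by `IsPrebiworld` below. -/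

/-- Raw objects of depth `μ`. -/
def Raw (V : Type u) (Ag : Type v) (μ : Ordinal.{0}) : Type (max 1 u v) :=
  limitRecOn (motive := fun _ => Type (max 1 u v)) μ
    (ULift.{max 1 v} (Set V))
    (fun _ T => Set V × (Ag → Set T) × (Ag → Set T))
    (fun μ _ T => ∀ α : Set.Iio μ, T α.1 α.2)

variable {V : Type u} {Ag : Type v}

/-- Raw objects of depth `0` are interpretations. -/
def zeroEquiv : Raw V Ag 0 ≃ Set V :=
  (Equiv.cast (limitRecOn_zero _ _ _)).trans Equiv.ulift

/-- Raw objects of depth `μ + 1` are triples. -/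
def succEquiv (μ : Ordinal.{0}) :
    Raw V Ag (μ + 1) ≃ Set V × (Ag → Set (Raw V Ag μ)) × (Ag → Set (Raw V Ag μ)) :=
  Equiv.cast (limitRecOn_add_one μ _ _ _)

/-- Raw objects of limit depth are sequences. -/
def limitEquiv {μ : Ordinal.{0}} (hμ : IsSuccLimit μ) :
    Raw V Ag μ ≃ (∀ α : Set.Iio μ, Raw V Ag α.1) :=
  Equiv.cast (limitRecOn_limit μ _ _ _ hμ)

/-- The raw object `(I, (P A)_A, (N A)_A)` of successor depth. -/
def mk {μ : Ordinal.{0}} (I : Set V) (P N : Ag → Set (Raw V Ag μ)) : Raw V Ag (μ + 1) :=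
  (succEquiv μ).symm (I, P, N)

/-- `A^w`, for `w` of successor depth. -/
def poss {μ : Ordinal.{0}} (A : Ag) (w : Raw V Ag (μ + 1)) : Set (Raw V Ag μ) :=
  (succEquiv μ w).2.1 A

/-- `Abar^w`, for `w` of successor depth. -/
def imposs {μ : Ordinal.{0}} (A : Ag) (w : Raw V Ag (μ + 1)) : Set (Raw V Ag μ) :=
  (succEquiv μ w).2.2 A

/-- `(w)_α`, the element in position `α < μ` of the sequence `w` of limit depth `μ`. -/
def seq {μ : Ordinal.{0}} (hμ : IsSuccLimit μ) (w : Raw V Ag μ) (α : Ordinal.{0}) (h : α < μ) :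
    Raw V Ag α :=
  limitEquiv hμ w ⟨α, h⟩

/-- The objective interpretation of `w`. -/
def obj (μ : Ordinal.{0}) : Raw V Ag μ → Set V :=
  limitRecOn (motive := fun μ => Raw V Ag μ → Set V) μ
    (fun w => zeroEquiv w)
    (fun μ _ w => (succEquiv μ w).1)
    (fun _ hμ _ w => zeroEquiv (seq hμ w 0 (zero_lt_of_limit hμ)))

/-- The restriction `w|_α` of `w` of depth `μ` to a depth `α ≤ μ`, by recursion on `α`. -/
def restr (α : Ordinal.{0}) : ∀ μ : Ordinal.{0}, α ≤ μ → Raw V Ag μ → Raw V Ag α :=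
  limitRecOn (motive := fun α => ∀ μ : Ordinal.{0}, α ≤ μ → Raw V Ag μ → Raw V Ag α) α
    (fun μ _ w => zeroEquiv.symm (obj μ w))
    (fun α ih μ =>
      limitRecOn (motive := fun μ => α + 1 ≤ μ → Raw V Ag μ → Raw V Ag (α + 1)) μ
        (fun h _ => absurd h not_add_one_le_zero)
        (fun μ _ h w => mk (obj (μ + 1) w)
          (fun A => ih μ (le_of_add_one_le_add_one h) '' poss A w)
          (fun A => ih μ (le_of_add_one_le_add_one h) '' imposs A w))
        (fun _ hμ _ h w => seq hμ w (α + 1) (add_one_lt_of_limit hμ (lt_of_add_one_le h))))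
    (fun _ hα ih μ h w => (limitEquiv hα).symm fun β => ih β.1 β.2 μ (β.2.le.trans h) w)

/-- Hereditarily increasing raw objects, that is, the `μ`-prebiworlds: at limit depths,
`(w)_β` is the restriction to `β` of `(w)_α` whenever `β ≤ α`. -/
def IsPrebiworld (μ : Ordinal.{0}) : Raw V Ag μ → Prop :=
  limitRecOn (motive := fun μ => Raw V Ag μ → Prop) μ
    (fun _ => True)
    (fun _ P w => ∀ A, (∀ x ∈ poss A w, P x) ∧ (∀ x ∈ imposs A w, P x))
    (fun μ hμ P w =>
      (∀ α (h : α < μ), P α h (seq hμ w α h)) ∧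
      ∀ α (h : α < μ) β (hβ : β ≤ α),
        restr β α hβ (seq hμ w α h) = seq hμ w β (hβ.trans_lt h))

/-- The precision order: `x` of depth `α` is less precise than `w` of depth `μ`. -/
def LePrec {α μ : Ordinal.{0}} (x : Raw V Ag α) (w : Raw V Ag μ) : Prop :=
  ∃ h : α ≤ μ, restr α μ h w = x

/-! ### Biworlds and incompleted prebiworlds -/

mutual

/-- The incompleted `μ`-prebiworlds, given the set `B` of `μ`-biworlds: the simultaneous least
solution, together with the `(μ + 1)`-biworlds, of the two defining conditions. -/
inductive IncompletedStep {μ : Ordinal.{0}} (B : Set (Raw V Ag μ)) : Raw V Ag μ → Prop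
  | intro (w : Raw V Ag μ) (x y : Raw V Ag (μ + 1)) (hw : IsPrebiworld μ w)
      (hx : BiworldStep B x) (hy : BiworldStep B y) (hne : x ≠ y)
      (hwx : LePrec w x) (hwy : LePrec w y) : IncompletedStep B w

/-- The `(μ + 1)`-biworlds, given the set `B` of `μ`-biworlds. -/
inductive BiworldStep {μ : Ordinal.{0}} (B : Set (Raw V Ag μ)) : Raw V Ag (μ + 1) → Prop
  | intro (w : Raw V Ag (μ + 1)) (hw : IsPrebiworld (μ + 1) w)
      (union : ∀ A, poss A w ∪ imposs A w = B)
      (inter : ∀ A, ∀ x, x ∈ poss A w → x ∈ imposs A w → IncompletedStep B x) :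
      BiworldStep B w

end

/-- The `μ`-biworlds, by transfinite recursion on `μ`. -/
def IsBiworld (μ : Ordinal.{0}) : Raw V Ag μ → Prop :=
  limitRecOn (motive := fun μ => Raw V Ag μ → Prop) μ
    (fun w => IsPrebiworld 0 w)
    (fun _ B w => BiworldStep {x | B x} w)
    (fun μ hμ B w => IsPrebiworld μ w ∧ ∀ α (h : α < μ), B α h (seq hμ w α h))

/-- Incompleted `μ`-prebiworlds. -/
def Incompleted (μ : Ordinal.{0}) (w : Raw V Ag μ) : Prop :=
  IncompletedStep {x | IsBiworld μ x} w

/-- Completed `μ`-prebiworlds. -/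
def Completed (μ : Ordinal.{0}) (w : Raw V Ag μ) : Prop :=
  ¬ Incompleted μ w

/-! ### The defining equations of the notions above -/

@[simp] theorem poss_mk {μ : Ordinal.{0}} (I : Set V) (P N : Ag → Set (Raw V Ag μ)) (A : Ag) :
    poss A (mk I P N) = P A := by simp [poss, mk]

@[simp] theorem imposs_mk {μ : Ordinal.{0}} (I : Set V) (P N : Ag → Set (Raw V Ag μ)) (A : Ag) :
    imposs A (mk I P N) = N A := by simp [imposs, mk]

theorem obj_zero (w : Raw V Ag 0) : obj 0 w = zeroEquiv w := by
  simp [obj]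

@[simp] theorem obj_mk {μ : Ordinal.{0}} (I : Set V) (P N : Ag → Set (Raw V Ag μ)) :
    obj (μ + 1) (mk I P N) = I := by simp [obj, mk]

theorem obj_limit {μ : Ordinal.{0}} (hμ : IsSuccLimit μ) (w : Raw V Ag μ) :
    obj μ w = zeroEquiv (seq hμ w 0 (zero_lt_of_limit hμ)) := by
  rw [obj, limitRecOn_limit _ _ _ _ hμ]

theorem eta_succ {μ : Ordinal.{0}} (w : Raw V Ag (μ + 1)) :
    mk (obj (μ + 1) w) (fun A => poss A w) (fun A => imposs A w) = w := by
  simp [mk, obj, poss, imposs]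

theorem restr_zero {μ : Ordinal.{0}} (h : 0 ≤ μ) (w : Raw V Ag μ) :
    restr 0 μ h w = zeroEquiv.symm (obj μ w) := by
  simp [restr]

theorem restr_succ_succ {α μ : Ordinal.{0}} (h : α + 1 ≤ μ + 1) (w : Raw V Ag (μ + 1)) :
    restr (α + 1) (μ + 1) h w = mk (obj (μ + 1) w)
      (fun A => restr α μ (le_of_add_one_le_add_one h) '' poss A w)
      (fun A => restr α μ (le_of_add_one_le_add_one h) '' imposs A w) := by
  rw [restr, limitRecOn_add_one, limitRecOn_add_one]
  rfl

theorem restr_succ_limit {α μ : Ordinal.{0}} (hμ : IsSuccLimit μ) (h : α + 1 ≤ μ)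
    (w : Raw V Ag μ) :
    restr (α + 1) μ h w = seq hμ w (α + 1) (add_one_lt_of_limit hμ (lt_of_add_one_le h)) := by
  rw [restr, limitRecOn_add_one, limitRecOn_limit _ _ _ _ hμ]

theorem seq_restr_limit {α μ : Ordinal.{0}} (hα : IsSuccLimit α) (h : α ≤ μ) (w : Raw V Ag μ)
    (β : Ordinal.{0}) (hβ : β < α) :
    seq hα (restr α μ h w) β hβ = restr β μ (hβ.le.trans h) w := by
  rw [restr, limitRecOn_limit _ _ _ _ hα]
  simp only [seq, Equiv.apply_symm_apply]
  rfl

theorem isPrebiworld_zero (w : Raw V Ag 0) : IsPrebiworld 0 w := by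
  simp [IsPrebiworld]

theorem isPrebiworld_succ_iff {μ : Ordinal.{0}} (w : Raw V Ag (μ + 1)) :
    IsPrebiworld (μ + 1) w ↔
      ∀ A, (∀ x ∈ poss A w, IsPrebiworld μ x) ∧ (∀ x ∈ imposs A w, IsPrebiworld μ x) := by
  rw [IsPrebiworld, limitRecOn_add_one]
  rfl

theorem isPrebiworld_limit_iff {μ : Ordinal.{0}} (hμ : IsSuccLimit μ) (w : Raw V Ag μ) :
    IsPrebiworld μ w ↔
      (∀ α (h : α < μ), IsPrebiworld α (seq hμ w α h)) ∧
      ∀ α (h : α < μ) β (h' : β < μ), β ≤ α → LePrec (seq hμ w β h') (seq hμ w α h) := by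
  rw [IsPrebiworld, limitRecOn_limit _ _ _ _ hμ]
  exact and_congr Iff.rfl
    ⟨fun H α h β _ hβ => ⟨hβ, H α h β hβ⟩, fun H α h β hβ => (H α h β _ hβ).2⟩

theorem isBiworld_zero (w : Raw V Ag 0) : IsBiworld 0 w := by
  rw [IsBiworld, limitRecOn_zero]
  exact isPrebiworld_zero w

theorem isBiworld_succ_iff {μ : Ordinal.{0}} (w : Raw V Ag (μ + 1)) :
    IsBiworld (μ + 1) w ↔ IsPrebiworld (μ + 1) w ∧
      ∀ A, poss A w ∪ imposs A w = {x | IsBiworld μ x} ∧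
        ∀ x ∈ poss A w ∩ imposs A w, Incompleted μ x := by
  rw [IsBiworld, limitRecOn_add_one]
  constructor
  · rintro ⟨_, h1, h2, h3⟩
    exact ⟨h1, fun A => ⟨h2 A, fun x hx => h3 A x hx.1 hx.2⟩⟩
  · rintro ⟨h1, h2⟩
    exact ⟨_, h1, fun A => (h2 A).1, fun A x hx hx' => (h2 A).2 x ⟨hx, hx'⟩⟩

theorem isBiworld_limit_iff {μ : Ordinal.{0}} (hμ : IsSuccLimit μ) (w : Raw V Ag μ) :
    IsBiworld μ w ↔ IsPrebiworld μ w ∧ ∀ α (h : α < μ), IsBiworld α (seq hμ w α h) := by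
  rw [IsBiworld, limitRecOn_limit _ _ _ _ hμ]
  rfl

theorem incompleted_iff {μ : Ordinal.{0}} (w : Raw V Ag μ) :
    Incompleted μ w ↔ IsPrebiworld μ w ∧ ∃ x y : Raw V Ag (μ + 1),
      IsBiworld (μ + 1) x ∧ IsBiworld (μ + 1) y ∧ x ≠ y ∧ LePrec w x ∧ LePrec w y := by
  have key : ∀ x : Raw V Ag (μ + 1),
      IsBiworld (μ + 1) x ↔ BiworldStep {x : Raw V Ag μ | IsBiworld μ x} x := by
    intro x
    conv_lhs => rw [IsBiworld, limitRecOn_add_one]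
    rfl
  constructor
  · rintro ⟨_, x, y, hw, hx, hy, hne, h1, h2⟩
    exact ⟨hw, x, y, (key x).2 hx, (key y).2 hy, hne, h1, h2⟩
  · rintro ⟨hw, x, y, hx, hy, hne, h1, h2⟩
    exact ⟨_, x, y, hw, (key x).1 hx, (key y).1 hy, hne, h1, h2⟩

/-! ### Truth values -/

/-- The truth values true, false and unknown. -/
inductive TV : Type
  | tt
  | ff
  | uu

namespace TV

/-- The inverse of a truth value. -/
def inv : TV → TV
  | tt => ff
  | ff => tt
  | uu => uu

/-- The truth order: false, unknown, true. -/
def leT : TV → TV → Prop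
  | ff, _ => True
  | uu, ff => False
  | uu, _ => True
  | tt, tt => True
  | tt, _ => False

/-- The precision order: unknown is below true and below false. -/
def leP (a b : TV) : Prop := a = uu ∨ a = b

open Classical in
/-- The greatest lower bound of a set of truth values in the truth order. -/
def glbT (S : Set TV) : TV :=
  if ff ∈ S then ff else if uu ∈ S then uu else tt

open Classical in
/-- The least upper bound of a set of truth values in the precision order, if it exists, that
is, unless `S` contains both true and false (in which case the value is irrelevant). -/
def lubP (S : Set TV) : TV :=
  if tt ∈ S ∧ ff ∉ S then tt else if ff ∈ S ∧ tt ∉ S then ff else uu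

theorem le_glbT_iff (S : Set TV) (a : TV) : leT a (glbT S) ↔ ∀ b ∈ S, leT a b := by
  unfold glbT
  constructor
  · intro h b hb
    cases b <;> cases a <;> simp_all [leT]
    split_ifs at h <;> simp_all
  · intro h
    split_ifs with h1 h2
    · exact h _ h1
    · exact h _ h2
    · cases a <;> trivial

theorem lubP_le_iff (S : Set TV) (hS : ¬ (tt ∈ S ∧ ff ∈ S)) (a : TV) :
    leP (lubP S) a ↔ ∀ b ∈ S, leP b a := by
  unfold lubP leP
  constructor
  · intro h b hb
    cases b <;> simp_all
  · intro h
    split_ifs with h1 h2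
    · exact Or.inr ((h _ h1.1).resolve_left (by simp))
    · exact Or.inr ((h _ h2.1).resolve_left (by simp))
    · exact Or.inl rfl

end TV

/-! ### The language and its three-valued valuation -/

/-- Formulas: propositional logic with the operators `K_A`, `M_A`, `E_G` and `C_G`. -/
inductive Formula (V : Type u) (Ag : Type v) : Type (max u v)
  | atom (p : V) : Formula V Ag
  | and (φ ψ : Formula V Ag) : Formula V Ag
  | neg (φ : Formula V Ag) : Formula V Ag
  | know (A : Ag) (φ : Formula V Ag) : Formula V Ag
  | most (A : Ag) (φ : Formula V Ag) : Formula V Ag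
  | every (G : Set Ag) (φ : Formula V Ag) : Formula V Ag
  | common (G : Set Ag) (φ : Formula V Ag) : Formula V Ag

/-- `E_G^k φ`. -/
def everyIter (G : Set Ag) (φ : Formula V Ag) : ℕ → Formula V Ag
  | 0 => φ
  | k + 1 => Formula.every G (everyIter G φ k)

/-- Families of truth values: candidates for the map sending `w` to `φ^w`. -/
abbrev Valuation (V : Type u) (Ag : Type v) : Type (max 1 u v) :=
  ∀ μ : Ordinal.{0}, Raw V Ag μ → TV

/-- The valuation of `K_A φ` in terms of that of `φ`. -/
def knowOp (A : Ag) (f : Valuation V Ag) : Valuation V Ag := fun μ =>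
  limitRecOn (motive := fun μ => Raw V Ag μ → TV) μ
    (fun _ => TV.uu)
    (fun μ _ w => TV.glbT {a | ∃ x ∈ poss A w, a = f μ x})
    (fun μ hμ g w => TV.lubP {a | ∃ (α : Ordinal.{0}) (h : α < μ), a = g α h (seq hμ w α h)})

/-- The valuation of `M_A φ` in terms of that of `φ`. -/
def mostOp (A : Ag) (f : Valuation V Ag) : Valuation V Ag := fun μ =>
  limitRecOn (motive := fun μ => Raw V Ag μ → TV) μ
    (fun _ => TV.uu)
    (fun μ _ w => TV.glbT {a | ∃ x ∈ imposs A w, a = (f μ x).inv})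
    (fun μ hμ g w => TV.lubP {a | ∃ (α : Ordinal.{0}) (h : α < μ), a = g α h (seq hμ w α h)})

/-- The valuation of `E_G φ` in terms of that of `φ`. -/
def everyOp (G : Set Ag) (f : Valuation V Ag) : Valuation V Ag := fun μ w =>
  TV.glbT {a | ∃ A ∈ G, a = knowOp A f μ w}

open Classical in
/-- The three-valued valuation `φ^w`, for `w` of any depth `μ`. -/
def val : Formula V Ag → Valuation V Ag
  | .atom p => fun μ w => if p ∈ obj μ w then TV.tt else TV.ff
  | .and φ ψ => fun μ w => TV.glbT {val φ μ w, val ψ μ w}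
  | .neg φ => fun μ w => (val φ μ w).inv
  | .know A φ => knowOp A (val φ)
  | .most A φ => mostOp A (val φ)
  | .every G φ => everyOp G (val φ)
  | .common G φ => fun μ w =>
      TV.glbT {a | ∃ k : ℕ, 1 ≤ k ∧ a = ((everyOp G)^[k] (val φ)) μ w}

theorem val_know_zero (A : Ag) (φ : Formula V Ag) (w : Raw V Ag 0) :
    val (.know A φ) 0 w = TV.uu := by
  simp [val, knowOp]

theorem val_know_succ (A : Ag) (φ : Formula V Ag) {μ : Ordinal.{0}} (w : Raw V Ag (μ + 1)) :
    val (.know A φ) (μ + 1) w = TV.glbT {a | ∃ x ∈ poss A w, a = val φ μ x} := by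
  simp [val, knowOp]

theorem val_know_limit (A : Ag) (φ : Formula V Ag) {μ : Ordinal.{0}} (hμ : IsSuccLimit μ)
    (w : Raw V Ag μ) :
    val (.know A φ) μ w =
      TV.lubP {a | ∃ (α : Ordinal.{0}) (h : α < μ), a = val (.know A φ) α (seq hμ w α h)} := by
  simp only [val]
  rw [knowOp, limitRecOn_limit _ _ _ _ hμ]
  rfl

theorem val_most_zero (A : Ag) (φ : Formula V Ag) (w : Raw V Ag 0) :
    val (.most A φ) 0 w = TV.uu := by
  simp [val, mostOp]

theorem val_most_succ (A : Ag) (φ : Formula V Ag) {μ : Ordinal.{0}} (w : Raw V Ag (μ + 1)) :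
    val (.most A φ) (μ + 1) w = TV.glbT {a | ∃ x ∈ imposs A w, a = (val φ μ x).inv} := by
  simp [val, mostOp]

theorem val_most_limit (A : Ag) (φ : Formula V Ag) {μ : Ordinal.{0}} (hμ : IsSuccLimit μ)
    (w : Raw V Ag μ) :
    val (.most A φ) μ w =
      TV.lubP {a | ∃ (α : Ordinal.{0}) (h : α < μ), a = val (.most A φ) α (seq hμ w α h)} := by
  simp only [val]
  rw [mostOp, limitRecOn_limit _ _ _ _ hμ]
  rfl

theorem val_every (G : Set Ag) (φ : Formula V Ag) (μ : Ordinal.{0}) (w : Raw V Ag μ) :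
    val (.every G φ) μ w = TV.glbT {a | ∃ A ∈ G, a = val (.know A φ) μ w} := rfl

theorem val_common (G : Set Ag) (φ : Formula V Ag) (μ : Ordinal.{0}) (w : Raw V Ag μ) :
    val (.common G φ) μ w =
      TV.glbT {a | ∃ k : ℕ, 1 ≤ k ∧ a = val (everyIter G φ k) μ w} := by
  have key : ∀ k : ℕ, (everyOp G)^[k] (val φ) = val (everyIter G φ k) := by
    intro k
    induction k with
    | zero => rfl
    | succ k ih => rw [Function.iterate_succ_apply', ih]; rfl
  simp only [val, key]

/-! ### Kripke semantics -/

/-- Kripke structures over the vocabulary `V` and the agents `Ag`. -/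
structure Kripke (V : Type u) (Ag : Type v) where
  /-- The worlds. -/
  World : Type (max 1 u v)
  /-- The interpretation attached to a world. -/
  interp : World → Set V
  /-- The accessibility relations. -/
  rel : Ag → World → World → Prop

/-- Satisfaction of a formula at a world of a Kripke structure.  `C_G φ` says that `φ` holds in
all worlds reachable by one or more steps along the relations of the agents in `G`. -/
def Kripke.Sat (K : Kripke V Ag) : Formula V Ag → K.World → Prop
  | .atom p, w => p ∈ K.interp w
  | .and φ ψ, w => K.Sat φ w ∧ K.Sat ψ w
  | .neg φ, w => ¬ K.Sat φ w
  | .know A φ, w => ∀ w', K.rel A w w' → K.Sat φ w'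
  | .most A φ, w => ∀ w', K.Sat φ w' → K.rel A w w'
  | .every G φ, w => ∀ A ∈ G, ∀ w', K.rel A w w' → K.Sat φ w'
  | .common G φ, w =>
      ∀ w', Relation.TransGen (fun x y => ∃ A ∈ G, K.rel A x y) w w' → K.Sat φ w'

open Classical in
/-- The two-valued valuation `φ^{K,w}`. -/
def Kripke.val (K : Kripke V Ag) (φ : Formula V Ag) (w : K.World) : TV :=
  if K.Sat φ w then TV.tt else TV.ff

/-- The ordinal `ω²`. -/
abbrev omegaSq : Ordinal.{0} := ω ^ (2 : Ordinal.{0})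

variable (V Ag) in
/-- The worlds: the completed `(ω² + 1)`-biworlds. -/
def World : Type (max 1 u v) :=
  {w : Raw V Ag (omegaSq + 1) // IsBiworld (omegaSq + 1) w ∧ Completed (omegaSq + 1) w}

variable (V Ag) in
/-- The canonical Kripke structure: its worlds are the completed `(ω² + 1)`-biworlds, and `w'` is
`A`-accessible from `w` if and only if `w'|_{ω²} ∈ A^w`. -/
def canonical : Kripke V Ag where
  World := World V Ag
  interp := fun w => obj (omegaSq + 1) w.1
  rel := fun A w w' =>
    restr omegaSq (omegaSq + 1) le_self_add w'.1 ∈ poss A w.1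

end Biworlds

end

noncomputable section

namespace Biworlds

open Ordinal Order

universe u v

variable {V : Type u} {Ag : Type v}

/-! ### Restrictions of prebiworlds -/

-- Each formula is two-valued in all prebiworlds from some depth `δ < ω²` on: `K_A`, `M_A` and `E_G`
-- cost one level, `C_G` costs `ω` levels because every `E_G^k` must be decided, and `ω²` is closed
-- under addition (`exists_decidedFrom`). The valuation is monotone in precision (`monotonic`), so
-- decided values never change; in particular a world and its restriction to `ω²` give every formula
-- the same value (`World.val_base`).
--
-- Matching the modal clauses with Kripke semantics takes two facts. Every `ω²`-biworld is the
-- restriction of a world (`exists_world`), so a bound over `A^w` is a quantifier over accessible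
-- worlds. The two sides `A^w`, `Abar^w` of a completed biworld are disjoint
-- (`disjoint_of_completed`), so `Abar^w` describes exactly the inaccessible worlds, as `M_A`
-- requires.
--
-- Both facts rest on the structure of biworlds of countable depth: restriction maps biworlds onto
-- biworlds (`regularUpTo_of_countable`), and a biworld has an extension with disjoint sides
-- (`exists_disjoint_extension`). The delicate point is to assign each world compatible with both
-- sides to one of them without either side losing a restriction. Non-isolated ones are split by a
-- two-colouring (`exists_splitting_coloring`); an isolated one goes to the side that needs it, and
-- it cannot be needed by both because its truncations are incompleted. Finally, if the sides of `w`
-- overlap in `x`, a disjoint extension of `w` has worlds over `x` on opposite sides; exchanging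
-- them gives a second extension, so `w` is incompleted.

theorem zero_or_add_one_or_limit (μ : Ordinal.{0}) :
    μ = 0 ∨ (∃ ν, μ = ν + 1) ∨ IsSuccLimit μ := by
  rcases zero_or_succ_or_isSuccLimit μ with h | ⟨ν, h⟩ | h
  · exact Or.inl h
  · exact Or.inr (Or.inl ⟨ν, by rw [← h, succ_eq_add_one]⟩)
  · exact Or.inr (Or.inr h)

/-- The possible worlds (for `true`) or impossible worlds (for `false`) of an agent. -/
def side (s : Bool) {μ : Ordinal.{0}} (A : Ag) (w : Raw V Ag (μ + 1)) : Set (Raw V Ag μ) :=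
  if s then poss A w else imposs A w

/-- The raw object with given sides. -/
def mkSides {μ : Ordinal.{0}} (I : Set V) (f : Bool → Ag → Set (Raw V Ag μ)) :
    Raw V Ag (μ + 1) :=
  mk I (f true) (f false)

@[simp] theorem side_mkSides {μ : Ordinal.{0}} (I : Set V) (f : Bool → Ag → Set (Raw V Ag μ))
    (s : Bool) (A : Ag) : side s A (mkSides I f) = f s A := by
  cases s <;> simp [side, mkSides]

@[simp] theorem obj_mkSides {μ : Ordinal.{0}} (I : Set V) (f : Bool → Ag → Set (Raw V Ag μ)) :
    obj (μ + 1) (mkSides I f) = I := by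
  simp [mkSides]

theorem ext_succ {μ : Ordinal.{0}} {v w : Raw V Ag (μ + 1)}
    (ho : obj (μ + 1) v = obj (μ + 1) w) (hs : ∀ s A, side s A v = side s A w) : v = w := by
  rw [← eta_succ v, ← eta_succ w, ho]
  congr 1
  · funext A; simpa [side] using hs true A
  · funext A; simpa [side] using hs false A

theorem ext_zero {v w : Raw V Ag 0} (ho : obj 0 v = obj 0 w) : v = w := by
  rw [obj_zero, obj_zero] at ho
  exact zeroEquiv.injective ho

theorem ext_limit {μ : Ordinal.{0}} (hμ : IsSuccLimit μ) {v w : Raw V Ag μ}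
    (h : ∀ α (hα : α < μ), seq hμ v α hα = seq hμ w α hα) : v = w :=
  (limitEquiv hμ).injective (funext fun α => h α.1 α.2)

theorem side_restr_succ {α μ : Ordinal.{0}} (h : α + 1 ≤ μ + 1) (w : Raw V Ag (μ + 1))
    (s : Bool) (A : Ag) :
    side s A (restr (α + 1) (μ + 1) h w) =
      restr α μ (le_of_add_one_le_add_one h) '' side s A w := by
  cases s <;> simp [restr_succ_succ, side]

theorem isPrebiworld_succ_iff_side {μ : Ordinal.{0}} (w : Raw V Ag (μ + 1)) :
    IsPrebiworld (μ + 1) w ↔ ∀ s A, ∀ x ∈ side s A w, IsPrebiworld μ x := by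
  rw [isPrebiworld_succ_iff]
  constructor
  · rintro h (_ | _) A
    · exact (h A).2
    · exact (h A).1
  · exact fun h A => ⟨h true A, h false A⟩

theorem isPrebiworld_seq {μ : Ordinal.{0}} (hμ : IsSuccLimit μ) {w : Raw V Ag μ}
    (hw : IsPrebiworld μ w) (α : Ordinal.{0}) (h : α < μ) : IsPrebiworld α (seq hμ w α h) :=
  ((isPrebiworld_limit_iff hμ w).1 hw).1 α h

theorem restr_seq {μ : Ordinal.{0}} (hμ : IsSuccLimit μ) {w : Raw V Ag μ}
    (hw : IsPrebiworld μ w) {α β : Ordinal.{0}} (h : α < μ) (hβ : β ≤ α) :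
    restr β α hβ (seq hμ w α h) = seq hμ w β (hβ.trans_lt h) :=
  (((isPrebiworld_limit_iff hμ w).1 hw).2 α h β (hβ.trans_lt h) hβ).2

theorem obj_restr {α μ : Ordinal.{0}} (h : α ≤ μ) {w : Raw V Ag μ} (hw : IsPrebiworld μ w) :
    obj α (restr α μ h w) = obj μ w := by
  rcases zero_or_add_one_or_limit α with rfl | ⟨α, rfl⟩ | hα
  · rw [restr_zero, obj_zero, Equiv.apply_symm_apply]
  · rcases zero_or_add_one_or_limit μ with rfl | ⟨μ, rfl⟩ | hμ
    · exact absurd h not_add_one_le_zero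
    · rw [restr_succ_succ, obj_mk]
    · rw [restr_succ_limit hμ h, obj_limit hμ]
      have := restr_seq hμ hw (add_one_lt_of_limit hμ (lt_of_add_one_le h)) (zero_le (a := α + 1))
      rw [← this, restr_zero, Equiv.apply_symm_apply]
  · rw [obj_limit hα, seq_restr_limit, restr_zero, Equiv.apply_symm_apply]

/-- The induction is on the smallest depth, with the other two general: at successors images
compose, and at limits entries are compared. Between a limit depth and a successor depth it is the
coherence of the sequence. -/
theorem restr_restr {β : Ordinal.{0}} : ∀ {α μ : Ordinal.{0}} (hβ : β ≤ α) (h : α ≤ μ)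
    {w : Raw V Ag μ}, IsPrebiworld μ w →
    restr β α hβ (restr α μ h w) = restr β μ (hβ.trans h) w := by
  induction β using limitRecOn with
  | zero =>
    intro α μ hβ h w hw
    rw [restr_zero, restr_zero, obj_restr h hw]
  | add_one β ih =>
    intro α μ hβ h w hw
    rcases zero_or_add_one_or_limit α with rfl | ⟨α, rfl⟩ | hα
    · exact absurd hβ not_add_one_le_zero
    · rcases zero_or_add_one_or_limit μ with rfl | ⟨μ, rfl⟩ | hμ
      · exact absurd h not_add_one_le_zero
      · have hw' := (isPrebiworld_succ_iff_side w).1 hw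
        apply ext_succ
        · rw [restr_succ_succ, obj_mk, restr_succ_succ, obj_mk, restr_succ_succ, obj_mk]
        · intro s A
          rw [side_restr_succ, side_restr_succ, side_restr_succ, Set.image_image]
          exact Set.image_congr fun x hx => ih _ _ (hw' s A x hx)
      · rw [restr_succ_limit hμ h, restr_seq hμ hw, restr_succ_limit hμ]
    · rw [restr_succ_limit hα, seq_restr_limit]
  | limit β hβl ih =>
    intro α μ hβ h w hw
    apply ext_limit hβl
    intro γ hγ
    rw [seq_restr_limit, seq_restr_limit, ih γ hγ _ _ hw]

theorem isPrebiworld_restr {α : Ordinal.{0}} : ∀ {μ : Ordinal.{0}} (h : α ≤ μ)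
    {w : Raw V Ag μ}, IsPrebiworld μ w → IsPrebiworld α (restr α μ h w) := by
  induction α using limitRecOn with
  | zero => exact fun _ _ _ => isPrebiworld_zero _
  | add_one α ih =>
    intro μ h w hw
    rcases zero_or_add_one_or_limit μ with rfl | ⟨μ, rfl⟩ | hμ
    · exact absurd h not_add_one_le_zero
    · rw [isPrebiworld_succ_iff_side]
      intro s A x hx
      rw [side_restr_succ] at hx
      obtain ⟨y, hy, rfl⟩ := hx
      exact ih _ ((isPrebiworld_succ_iff_side w).1 hw s A y hy)
    · rw [restr_succ_limit hμ h]
      exact isPrebiworld_seq hμ hw _ _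
  | limit α hα ih =>
    intro μ h w hw
    rw [isPrebiworld_limit_iff hα]
    constructor
    · intro β hβ
      rw [seq_restr_limit]
      exact ih β hβ _ hw
    · intro β hβ γ hγ hγβ
      refine ⟨hγβ, ?_⟩
      rw [seq_restr_limit, seq_restr_limit, restr_restr _ _ hw]

/-- At limit depth the first claim is the second, entry by entry. The second is delicate for limit
`α`, where `restr` builds a new sequence instead of reading off an entry. -/
theorem restr_self_and_limit (μ : Ordinal.{0}) : ∀ w : Raw V Ag μ, IsPrebiworld μ w →
    restr μ μ le_rfl w = w ∧ ∀ (hμ : IsSuccLimit μ) α (h : α < μ),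
      restr α μ h.le w = seq hμ w α h := by
  induction μ using WellFoundedLT.induction with
  | ind μ ih =>
    intro w hw
    have key : ∀ (hμ : IsSuccLimit μ) α (h : α < μ), restr α μ h.le w = seq hμ w α h := by
      intro hμ α h
      rcases zero_or_add_one_or_limit α with rfl | ⟨α, rfl⟩ | hα
      · rw [restr_zero, obj_limit hμ, Equiv.symm_apply_apply]
      · rw [restr_succ_limit hμ]
      · have h1 := restr_seq hμ hw h le_rfl
        rw [← h1]
        apply ext_limit hα
        intro β hβ
        rw [seq_restr_limit, seq_restr_limit, restr_seq hμ hw]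
        -- Since `β` may again be a limit, pass through `β + 1`, where restricting `w` does read off
        -- an entry.
        have h2 := restr_restr (le_self_add : β ≤ β + 1)
          ((add_one_lt_of_limit hμ (hβ.trans h)).le) hw
        rw [← h2, restr_succ_limit hμ, restr_seq hμ hw]
    refine ⟨?_, key⟩
    rcases zero_or_add_one_or_limit μ with rfl | ⟨μ, rfl⟩ | hμ
    · exact ext_zero (obj_restr _ hw)
    · apply ext_succ (obj_restr _ hw)
      intro s A
      rw [side_restr_succ]
      conv_rhs => rw [← Set.image_id (side s A w)]
      exact Set.image_congr fun x hx => (ih μ (lt_add_one μ) x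
        ((isPrebiworld_succ_iff_side w).1 hw s A x hx)).1
    · apply ext_limit hμ
      intro α hα
      rw [seq_restr_limit, key hμ]

theorem restr_self {μ : Ordinal.{0}} {w : Raw V Ag μ} (hw : IsPrebiworld μ w) :
    restr μ μ le_rfl w = w :=
  (restr_self_and_limit μ w hw).1

theorem restr_limit {μ : Ordinal.{0}} (hμ : IsSuccLimit μ) {w : Raw V Ag μ}
    (hw : IsPrebiworld μ w) {α : Ordinal.{0}} (h : α < μ) :
    restr α μ h.le w = seq hμ w α h :=
  (restr_self_and_limit μ w hw).2 hμ α h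

/-- Prebiworlds are determined by their restrictions to successor depths. -/
theorem eq_of_restr_succ_eq {μ : Ordinal.{0}} {v w : Raw V Ag μ} (hv : IsPrebiworld μ v)
    (hw : IsPrebiworld μ w) (ho : obj μ v = obj μ w)
    (h : ∀ α (hα : α + 1 ≤ μ), restr (α + 1) μ hα v = restr (α + 1) μ hα w) : v = w := by
  rcases zero_or_add_one_or_limit μ with rfl | ⟨μ, rfl⟩ | hμ
  · exact ext_zero ho
  · rw [← restr_self hv, ← restr_self hw]
    exact h μ le_rfl
  · apply ext_limit hμ
    intro α hα
    have h1 := (add_one_lt_of_limit hμ hα)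
    rw [← restr_limit hμ hv, ← restr_limit hμ hw, ← restr_restr (le_self_add : α ≤ α + 1) h1.le hv,
      h α h1.le, restr_restr _ _ hw]

/-- Two prebiworlds that agree at depth `α` and differ, first differ at a successor depth. -/
theorem exists_first_difference {μ : Ordinal.{0}} {v w : Raw V Ag μ} (hv : IsPrebiworld μ v)
    (hw : IsPrebiworld μ w) (hne : v ≠ w) {α : Ordinal.{0}} (hα : α ≤ μ)
    (h : restr α μ hα v = restr α μ hα w) :
    ∃ (β : Ordinal.{0}) (hβ : β + 1 ≤ μ), α ≤ β ∧
      restr β μ (lt_of_add_one_le hβ).le v = restr β μ (lt_of_add_one_le hβ).le w ∧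
      restr (β + 1) μ hβ v ≠ restr (β + 1) μ hβ w := by
  by_contra! hcon
  -- Agreement propagates upwards from `α`: `hcon` carries it through successors, and entries
  -- determine a limit.
  have key : ∀ β (hβ : β ≤ μ), α ≤ β → restr β μ hβ v = restr β μ hβ w := by
    intro β
    induction β using WellFoundedLT.induction with
    | ind β ih =>
      intro hβ hαβ
      rcases hαβ.eq_or_lt with rfl | hlt
      · exact h
      rcases zero_or_add_one_or_limit β with rfl | ⟨β, rfl⟩ | hβl
      · exact absurd hlt not_lt_zero
      · have h1 : α ≤ β := by simpa using hlt
        exact hcon β hβ h1 (ih β (lt_add_one β) _ h1)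
      · apply ext_limit hβl
        intro γ hγ
        rw [seq_restr_limit, seq_restr_limit]
        rcases le_total α γ with h1 | h1
        · exact ih γ hγ _ h1
        · rw [← restr_restr h1 hα hv, h, restr_restr _ _ hw]
  apply hne
  rw [← restr_self hv, ← restr_self hw]
  exact key μ le_rfl hα

/-- The sides of the truncations form a coherent family, even when `μ` is a limit and `w` has no
sides itself. Hence failing to lie on a side persists at greater depths. -/
theorem side_restr_add_one {α β μ : Ordinal.{0}} (hα : α ≤ β) (hβ : β + 1 ≤ μ)
    {w : Raw V Ag μ} (hw : IsPrebiworld μ w) (s : Bool) (A : Ag) :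
    side s A (restr (α + 1) μ ((add_le_add_left hα 1).trans hβ) w) =
      restr α β hα '' side s A (restr (β + 1) μ hβ w) := by
  rw [← restr_restr (add_le_add_left hα 1) hβ hw, side_restr_succ]

/-- A criterion for an object of successor depth to extend a given prebiworld. -/
theorem restr_eq_of_sides {μ : Ordinal.{0}} {v : Raw V Ag (μ + 1)} {y : Raw V Ag μ}
    (hv : IsPrebiworld (μ + 1) v) (hy : IsPrebiworld μ y) (ho : obj (μ + 1) v = obj μ y)
    (h : ∀ α (hα : α + 1 ≤ μ) s A,
      restr α μ (lt_of_add_one_le hα).le '' side s A v = side s A (restr (α + 1) μ hα y)) :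
    restr μ (μ + 1) le_self_add v = y := by
  apply eq_of_restr_succ_eq (isPrebiworld_restr _ hv) hy
  · rw [obj_restr _ hv, ho]
  · intro α hα
    rw [restr_restr _ _ hv]
    apply ext_succ
    · rw [obj_restr _ hv, obj_restr _ hy, ho]
    · intro s A
      rw [side_restr_succ, ← h]

theorem side_of_restr {μ : Ordinal.{0}} {v : Raw V Ag (μ + 1)} (hv : IsPrebiworld (μ + 1) v)
    {α : Ordinal.{0}} (hα : α + 1 ≤ μ) (s : Bool) (A : Ag) :
    side s A (restr (α + 1) μ hα (restr μ (μ + 1) le_self_add v)) =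
      restr α μ (lt_of_add_one_le hα).le '' side s A v := by
  rw [restr_restr _ _ hv, side_restr_succ]

/-! ### Biworlds, incompleted prebiworlds and restrictions -/

theorem IsBiworld.isPrebiworld {μ : Ordinal.{0}} {w : Raw V Ag μ} (hw : IsBiworld μ w) :
    IsPrebiworld μ w := by
  rcases zero_or_add_one_or_limit μ with rfl | ⟨ν, rfl⟩ | hμ
  · exact isPrebiworld_zero w
  · exact ((isBiworld_succ_iff w).1 hw).1
  · exact ((isBiworld_limit_iff hμ w).1 hw).1

theorem isBiworld_succ_iff_side {μ : Ordinal.{0}} (w : Raw V Ag (μ + 1)) :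
    IsBiworld (μ + 1) w ↔
      ∀ A, (∀ x, IsBiworld μ x ↔ ∃ s, x ∈ side s A w) ∧
        ∀ x, (∀ s, x ∈ side s A w) → Incompleted μ x := by
  rw [isBiworld_succ_iff]
  have h1 : ∀ A x, (∃ s, x ∈ side s A w) ↔ x ∈ poss A w ∪ imposs A w := by
    intro A x
    simp [side, or_comm]
  have h2 : ∀ A x, (∀ s, x ∈ side s A w) ↔ x ∈ poss A w ∩ imposs A w := by
    intro A x
    simp [side, and_comm]
  simp only [h1, h2]
  constructor
  · rintro ⟨-, h⟩ A
    exact ⟨fun x => by rw [(h A).1]; rfl, (h A).2⟩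
  · intro h
    refine ⟨?_, fun A => ⟨Set.ext fun x => ((h A).1 x).symm, (h A).2⟩⟩
    rw [isPrebiworld_succ_iff]
    exact fun A => ⟨fun x hx => (((h A).1 x).2 (Or.inl hx)).isPrebiworld,
      fun x hx => (((h A).1 x).2 (Or.inr hx)).isPrebiworld⟩

theorem IsBiworld.of_mem_side {μ : Ordinal.{0}} {w : Raw V Ag (μ + 1)}
    (hw : IsBiworld (μ + 1) w) {s : Bool} {A : Ag} {x : Raw V Ag μ} (hx : x ∈ side s A w) :
    IsBiworld μ x :=
  (((isBiworld_succ_iff_side w).1 hw A).1 x).2 ⟨s, hx⟩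

theorem IsBiworld.exists_mem_side {μ : Ordinal.{0}} {w : Raw V Ag (μ + 1)}
    (hw : IsBiworld (μ + 1) w) (A : Ag) {x : Raw V Ag μ} (hx : IsBiworld μ x) :
    ∃ s, x ∈ side s A w :=
  (((isBiworld_succ_iff_side w).1 hw A).1 x).1 hx

theorem IsBiworld.incompleted {μ : Ordinal.{0}} {w : Raw V Ag (μ + 1)}
    (hw : IsBiworld (μ + 1) w) {A : Ag} {x : Raw V Ag μ} (hx : ∀ s, x ∈ side s A w) :
    Incompleted μ x :=
  ((isBiworld_succ_iff_side w).1 hw A).2 x hx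

theorem incompleted_iff_restr {μ : Ordinal.{0}} (w : Raw V Ag μ) :
    Incompleted μ w ↔ ∃ x y : Raw V Ag (μ + 1), IsBiworld (μ + 1) x ∧ IsBiworld (μ + 1) y ∧
      x ≠ y ∧ restr μ (μ + 1) le_self_add x = w ∧ restr μ (μ + 1) le_self_add y = w := by
  rw [incompleted_iff]
  constructor
  · rintro ⟨-, x, y, hx, hy, hne, ⟨_, h1⟩, ⟨_, h2⟩⟩
    exact ⟨x, y, hx, hy, hne, h1, h2⟩
  · rintro ⟨x, y, hx, hy, hne, h1, h2⟩
    exact ⟨h1 ▸ isPrebiworld_restr _ hx.isPrebiworld, x, y, hx, hy, hne, ⟨_, h1⟩, ⟨_, h2⟩⟩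

/-- Every `β`-biworld restricts to an `α`-biworld and every `α`-biworld extends to
a `β`-biworld. -/
def Regular (V : Type u) (Ag : Type v) {α β : Ordinal.{0}} (h : α ≤ β) : Prop :=
  (∀ w : Raw V Ag β, IsBiworld β w → IsBiworld α (restr α β h w)) ∧
  ∀ x : Raw V Ag α, IsBiworld α x → ∃ w : Raw V Ag β, IsBiworld β w ∧ restr α β h w = x

/-- Restriction maps `β`-biworlds onto `α`-biworlds for all `α ≤ β ≤ μ`. -/
def RegularUpTo (V : Type u) (Ag : Type v) (μ : Ordinal.{0}) : Prop :=
  ∀ α β (h : α ≤ β), β ≤ μ → Regular V Ag h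

theorem RegularUpTo.mono {μ ν : Ordinal.{0}} (H : RegularUpTo V Ag μ) (h : ν ≤ μ) :
    RegularUpTo V Ag ν :=
  fun α β hαβ hβ => H α β hαβ (hβ.trans h)

theorem Regular.trans {α β γ : Ordinal.{0}} {h : α ≤ β} {h' : β ≤ γ}
    (H : Regular V Ag h) (H' : Regular V Ag h') : Regular V Ag (h.trans h') := by
  constructor
  · intro w hw
    rw [← restr_restr h h' hw.isPrebiworld]
    exact H.1 _ (H'.1 w hw)
  · intro x hx
    obtain ⟨y, hy, rfl⟩ := H.2 x hx
    obtain ⟨z, hz, rfl⟩ := H'.2 y hy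
    exact ⟨z, hz, (restr_restr h h' hz.isPrebiworld).symm⟩

theorem Regular.refl (μ : Ordinal.{0}) : Regular V Ag (le_refl μ) :=
  ⟨fun w hw => by rwa [restr_self hw.isPrebiworld],
    fun x hx => ⟨x, hx, restr_self hx.isPrebiworld⟩⟩

-- Overlapping sides, incompletedness and restriction to smaller depths

/-- Two distinct biworlds extending `w` share a world that is on both sides for `w`. -/
theorem exists_common_of_ne {μ : Ordinal.{0}} {x y : Raw V Ag (μ + 1)}
    (hx : IsBiworld (μ + 1) x) (hy : IsBiworld (μ + 1) y) (hne : x ≠ y)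
    (hr : restr μ (μ + 1) le_self_add x = restr μ (μ + 1) le_self_add y) :
    ∃ A z, IsBiworld μ z ∧ ∀ α (hα : α + 1 ≤ μ) s,
      restr α μ (lt_of_add_one_le hα).le z ∈
        side s A (restr (α + 1) μ hα (restr μ (μ + 1) le_self_add x)) := by
  -- Otherwise every biworld `z` is absent from one common side of `x` and `y`; as it lies on some
  -- side of each, it lies on the same side of both, and `x = y`.
  have key : ∃ A z, ∀ s, z ∈ side s A x ∨ z ∈ side s A y := by
    by_contra! hcon
    apply hne
    have aux : ∀ {a b : Raw V Ag (μ + 1)}, IsBiworld (μ + 1) a → IsBiworld (μ + 1) b →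
        (∀ A z, ∃ s, z ∉ side s A a ∧ z ∉ side s A b) →
        ∀ s A, side s A a ⊆ side s A b := by
      intro a b ha hb hab s A z hz
      obtain ⟨t, ht, ht'⟩ := hab A z
      obtain ⟨r, hr⟩ := hb.exists_mem_side A (ha.of_mem_side hz)
      have h1 : t ≠ s := by rintro rfl; exact ht hz
      have h2 : t ≠ r := by rintro rfl; exact ht' hr
      have : r = s := by
        cases t <;> cases r <;> cases s <;> simp_all
      rwa [← this]
    refine ext_succ ?_ fun s A => (aux hx hy hcon s A).antisymm
      (aux hy hx (fun A z => (hcon A z).imp fun _ h => h.symm) s A)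
    rw [← obj_restr (le_self_add : μ ≤ μ + 1) hx.isPrebiworld, hr, obj_restr _ hy.isPrebiworld]
  obtain ⟨A, z, hz⟩ := key
  refine ⟨A, z, (hz true).elim hx.of_mem_side hy.of_mem_side, fun α hα s => ?_⟩
  rcases hz s with h | h
  · rw [side_of_restr hx.isPrebiworld]
    exact ⟨z, h, rfl⟩
  · rw [hr, side_of_restr hy.isPrebiworld]
    exact ⟨z, h, rfl⟩

/-- A `μ`-biworld with an incompleted restriction is not determined by it. -/
theorem exists_ne_of_incompleted {μ : Ordinal.{0}} (H : RegularUpTo V Ag μ) {α : Ordinal.{0}}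
    (hα : α + 1 ≤ μ) (z : Raw V Ag μ)
    (hz : Incompleted α (restr α μ (lt_of_add_one_le hα).le z)) :
    ∃ x : Raw V Ag μ, IsBiworld μ x ∧ x ≠ z ∧ restr α μ (lt_of_add_one_le hα).le x =
      restr α μ (lt_of_add_one_le hα).le z ∧
      restr (α + 1) μ hα x ≠ restr (α + 1) μ hα z := by
  obtain ⟨a, b, ha, hb, hne, ha', hb'⟩ := (incompleted_iff_restr _).1 hz
  have : ∃ c, IsBiworld (α + 1) c ∧ restr α (α + 1) le_self_add c =
      restr α μ (lt_of_add_one_le hα).le z ∧ c ≠ restr (α + 1) μ hα z := by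
    by_cases h : a = restr (α + 1) μ hα z
    · exact ⟨b, hb, hb', fun h' => hne (h.trans h'.symm)⟩
    · exact ⟨a, ha, ha', h⟩
  obtain ⟨c, hc, hc', hcz⟩ := this
  obtain ⟨x, hx, rfl⟩ := (H _ _ hα le_rfl).2 c hc
  refine ⟨x, hx, ?_, ?_, hcz⟩
  · rintro rfl; exact hcz rfl
  · rw [← hc', restr_restr _ _ hx.isPrebiworld]

/-- If the two sides of a biworld `v` meet, then the restriction of `v` one level down is
incompleted. -/
theorem incompleted_restr_of_mem_sides {μ : Ordinal.{0}} (H : RegularUpTo V Ag (μ + 1))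
    {v : Raw V Ag (μ + 1)} (hv : IsBiworld (μ + 1) v) {A : Ag} {z : Raw V Ag μ}
    (hz : ∀ s, z ∈ side s A v) : Incompleted μ (restr μ (μ + 1) le_self_add v) := by
  classical
  -- No truncation of `z` below `μ` isolates it: each lies on both sides of a truncation of `v`,
  -- hence is incompleted.
  have hne : ∀ α (hα : α + 1 ≤ μ), ∃ x : Raw V Ag μ, IsBiworld μ x ∧ x ≠ z ∧
      restr α μ (lt_of_add_one_le hα).le x = restr α μ (lt_of_add_one_le hα).le z := by
    intro α hα
    have h1 := (H (α + 1) (μ + 1) (add_le_add_left (lt_of_add_one_le hα).le 1) le_rfl).1 v hv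
    have h2 : Incompleted α (restr α μ (lt_of_add_one_le hα).le z) := by
      apply h1.incompleted (A := A)
      intro s
      rw [side_restr_succ]
      exact ⟨z, hz s, rfl⟩
    obtain ⟨x, hx, h3, h4, -⟩ := exists_ne_of_incompleted (H.mono le_self_add) hα z h2
    exact ⟨x, hx, h3, h4⟩
  -- Pigeonhole: if side `t` had no approximation of `z` at depth `a t`, neither side would have one
  -- at the larger of the two depths.
  have key : ∃ t, ∀ α (hα : α + 1 ≤ μ), ∃ x ∈ side t A v, x ≠ z ∧
      restr α μ (lt_of_add_one_le hα).le x = restr α μ (lt_of_add_one_le hα).le z := by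
    by_contra! hcon
    choose a ha hcon using hcon
    obtain ⟨m, hm, hm'⟩ : ∃ m, m + 1 ≤ μ ∧ ∀ t, a t ≤ m := by
      rcases le_total (a true) (a false) with h | h
      · exact ⟨a false, ha false, by rintro (_ | _) <;> simp [h]⟩
      · exact ⟨a true, ha true, by rintro (_ | _) <;> simp [h]⟩
    obtain ⟨x, hx, hxz, hr⟩ := hne m hm
    obtain ⟨t, ht⟩ := hv.exists_mem_side A hx
    apply hcon t x ht hxz
    have hz' := hv.of_mem_side (hz t)
    rw [← restr_restr (hm' t) (lt_of_add_one_le hm).le hx.isPrebiworld, hr,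
      restr_restr _ _ hz'.isPrebiworld]
  obtain ⟨t, ht⟩ := key
  -- A second extension arises by deleting `z` from side `t` for `A`. It stays on the other side,
  -- and its truncations on side `t` are still realised by the approximations.
  let v' : Raw V Ag (μ + 1) := mkSides (obj (μ + 1) v)
    fun s B => if s = t ∧ B = A then side s B v \ {z} else side s B v
  have hsub : ∀ s B, side s B v' ⊆ side s B v := by
    intro s B
    simp only [v', side_mkSides]
    split_ifs
    · exact Set.sdiff_subset
    · exact subset_rfl
  have hmem : ∀ s B x, x ∈ side s B v → (s = t → B = A → x ≠ z) → x ∈ side s B v' := by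
    intro s B x hx h
    simp only [v', side_mkSides]
    split_ifs with h'
    · exact ⟨hx, h h'.1 h'.2⟩
    · exact hx
  have hz' : z ∉ side t A v' := by
    simp [v']
  have hv' : IsBiworld (μ + 1) v' := by
    rw [isBiworld_succ_iff_side]
    refine fun B => ⟨fun x => ⟨fun hx => ?_, fun ⟨s, hx⟩ => hv.of_mem_side (hsub s B hx)⟩,
      fun x hx => hv.incompleted fun s => hsub s B (hx s)⟩
    by_cases h : B = A ∧ x = z
    · obtain ⟨rfl, rfl⟩ := h
      exact ⟨!t, hmem _ _ _ (hz _) fun h => by simp at h⟩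
    · obtain ⟨s, hs⟩ := hv.exists_mem_side B hx
      exact ⟨s, hmem _ _ _ hs fun _ h1 h2 => h ⟨h1, h2⟩⟩
  rw [incompleted_iff_restr]
  refine ⟨v, v', hv, hv', fun h => hz' (h ▸ hz t), rfl, ?_⟩
  apply restr_eq_of_sides hv'.isPrebiworld (isPrebiworld_restr _ hv.isPrebiworld)
  · rw [obj_restr _ hv.isPrebiworld, obj_mkSides]
  · intro α hα s B
    rw [side_of_restr hv.isPrebiworld]
    apply Set.Subset.antisymm (Set.image_mono (hsub s B))
    rintro _ ⟨x, hx, rfl⟩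
    by_cases h : s = t ∧ B = A ∧ x = z
    · obtain ⟨rfl, rfl, rfl⟩ := h
      obtain ⟨y, hy, hyx, hr⟩ := ht α hα
      exact ⟨y, hmem _ _ _ hy fun _ _ => hyx, hr⟩
    · exact ⟨x, hmem _ _ _ hx fun h1 h2 h3 => h ⟨h1, h2, h3⟩, rfl⟩

/-- The working form of incompletedness: one world has all its truncations on both sides, for a
single agent. It remains meaningful at limit depth, where `w` has no sides of its own. -/
theorem Incompleted.exists_common {μ : Ordinal.{0}} {w : Raw V Ag μ} (hw : Incompleted μ w) :
    ∃ A z, IsBiworld μ z ∧ ∀ α (hα : α + 1 ≤ μ) s,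
      restr α μ (lt_of_add_one_le hα).le z ∈ side s A (restr (α + 1) μ hα w) := by
  obtain ⟨x, y, hx, hy, hne, rfl, h⟩ := (incompleted_iff_restr _).1 hw
  exact exists_common_of_ne hx hy hne h.symm

/-- The common world shows that the sides of the truncation of `w` to `α + 1` meet, which makes the
truncation one level lower incompleted. -/
theorem Incompleted.restr {μ : Ordinal.{0}} (H : RegularUpTo V Ag μ) {w : Raw V Ag μ}
    (hb : IsBiworld μ w) (hw : Incompleted μ w) {α : Ordinal.{0}} (hα : α + 1 ≤ μ) :
    Incompleted α (restr α μ (lt_of_add_one_le hα).le w) := by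
  obtain ⟨A, z, -, hz⟩ := hw.exists_common
  rw [← restr_restr (le_self_add : α ≤ α + 1) hα hb.isPrebiworld]
  exact incompleted_restr_of_mem_sides (H.mono hα) ((H _ _ hα le_rfl).1 w hb) (hz α hα)

theorem isBiworld_of_restr_succ {μ : Ordinal.{0}} {w : Raw V Ag μ} (hw : IsPrebiworld μ w)
    (H : ∀ α, α + 1 < μ → Regular V Ag (le_self_add : α ≤ α + 1))
    (h : ∀ α (hα : α + 1 ≤ μ), IsBiworld (α + 1) (restr (α + 1) μ hα w)) : IsBiworld μ w := by
  rcases zero_or_add_one_or_limit μ with rfl | ⟨ν, rfl⟩ | hμ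
  · exact isBiworld_zero w
  · rw [← restr_self hw]
    exact h ν le_rfl
  · rw [isBiworld_limit_iff hμ]
    refine ⟨hw, fun α hα => ?_⟩
    have h1 := add_one_lt_of_limit hμ hα
    rw [← restr_limit hμ hw, ← restr_restr le_self_add h1.le hw]
    exact (H α h1).1 _ (h α h1.le)

/-- It suffices to test successor depths. Surjectivity of restriction gives the union condition; the
overlap condition is the real content, since images of disjoint sides may meet. -/
theorem isBiworld_restr_succ {μ : Ordinal.{0}} (H : RegularUpTo V Ag μ) {w : Raw V Ag (μ + 1)}
    (hw : IsBiworld (μ + 1) w) : IsBiworld μ (restr μ (μ + 1) le_self_add w) := by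
  have hp := hw.isPrebiworld
  refine isBiworld_of_restr_succ (isPrebiworld_restr _ hp) (fun α hα => H _ _ _ hα.le)
    fun α hα => ?_
  have hαμ := (lt_of_add_one_le hα).le
  rw [isBiworld_succ_iff_side]
  intro A
  simp only [side_of_restr hp]
  constructor
  · intro x
    constructor
    · intro hx
      obtain ⟨y, hy, rfl⟩ := (H α μ hαμ le_rfl).2 x hx
      obtain ⟨s, hs⟩ := hw.exists_mem_side A hy
      exact ⟨s, y, hs, rfl⟩
    · rintro ⟨s, y, hs, rfl⟩
      exact (H α μ hαμ le_rfl).1 y (hw.of_mem_side hs)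
  · intro x hx
    obtain ⟨y, hy, hyx⟩ := hx true
    obtain ⟨z, hz, rfl⟩ := hx false
    have hyb := hw.of_mem_side hy
    have hzb := hw.of_mem_side hz
    by_cases hyz : y = z
    · subst hyz
      exact (hw.incompleted (A := A) (by rintro (_ | _) <;> assumption)).restr H hyb hα
    -- Where `y` and `z` first part, at `β + 1`, their truncations are two extensions of one
    -- `β`-biworld. So that biworld is incompleted, and incompletedness descends to `α`.
    · obtain ⟨β, hβ, hαβ, h1, h2⟩ :=
        exists_first_difference hyb.isPrebiworld hzb.isPrebiworld hyz hαμ hyx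
      have hβμ := (lt_of_add_one_le hβ).le
      have hI : Incompleted β (restr β μ hβμ z) := by
        rw [incompleted_iff_restr]
        refine ⟨_, _, (H _ _ hβ le_rfl).1 y hyb, (H _ _ hβ le_rfl).1 z hzb, h2, ?_, ?_⟩
        · rw [restr_restr _ _ hyb.isPrebiworld, h1]
        · rw [restr_restr _ _ hzb.isPrebiworld]
      rcases hαβ.eq_or_lt with rfl | hlt
      · exact hI
      · have := hI.restr (H.mono hβμ) ((H _ _ hβμ le_rfl).1 z hzb)
          (α := α) (by simpa using hlt)
        rwa [restr_restr _ _ hzb.isPrebiworld] at this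

/-! ### Two-colourings that split all classes of a chain of equivalence relations -/

/-- Given a decreasing chain of equivalence relations such that distinct points first differ at
a successor, there is a two-colouring in which each class with at least two points has points
of both colours. -/
theorem exists_splitting_coloring {S : Type*} (E : Ordinal.{0} → S → S → Prop)
    (hE : ∀ i, Equivalence (E i)) (hanti : ∀ i j x y, i ≤ j → E j x y → E i x y)
    (hfirst : ∀ i x y, x ≠ y → E i x y → ∃ j, i ≤ j ∧ E j x y ∧ ¬ E (j + 1) x y) :
    ∃ c : S → Bool, ∀ i x y, x ≠ y → E i x y → ∀ b, ∃ z, E i x z ∧ c z = b := by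
  classical
  obtain ⟨_, _⟩ := exists_wellFoundedLT S
  have hex : ∀ i x, ∃ m, E i x m ∧ ∀ z, E i x z → m ≤ z := by
    intro i x
    have hne : {z | E i x z}.Nonempty := ⟨x, (hE i).refl x⟩
    exact ⟨wellFounded_lt.min _ hne, wellFounded_lt.min_mem _ hne,
      fun z hz => wellFounded_lt.min_le hz⟩
  choose m hm hmin using hex
  have hcongr : ∀ i x y, E i x y → m i x = m i y := fun i x y h =>
    le_antisymm (hmin i x _ ((hE i).trans h (hm i y)))
      (hmin i y _ ((hE i).trans ((hE i).symm h) (hm i x)))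
  have hle : ∀ i x, m i x ≤ x := fun i x => hmin i x x ((hE i).refl x)
  -- Here `m i x` is the least element of the `i`-class of `x` in a well-order. A point that becomes
  -- least in its class exactly at stage `j + 1` takes the colour opposite to the least element of
  -- its `j`-class.
  let c : S → Bool := wellFounded_lt.fix fun z ih =>
    if h : ∃ j, m j z ≠ z ∧ m (j + 1) z = z then
      !(ih (m h.choose z) (lt_of_le_of_ne (hle _ _) h.choose_spec.1)) else true
  have hc : ∀ z j, m j z ≠ z → m (j + 1) z = z → c z = !c (m j z) := by
    intro z j h1 h2
    have h : ∃ j, m j z ≠ z ∧ m (j + 1) z = z := ⟨j, h1, h2⟩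
    -- Classes shrink, so being least in one's class persists; hence the stage `j` is unique and the
    -- choice in `c` is harmless.
    have huniq : ∀ i j, m i z ≠ z → m (j + 1) z = z → i ≤ j := by
      intro i j h3 h4
      by_contra! hlt
      apply h3
      apply le_antisymm (hle i z)
      rw [← h4]
      conv_rhs => rw [h4]
      exact hmin _ _ _ (hanti _ _ _ _ (by simpa using hlt) (hm i z))
    have h3 : h.choose = j :=
      le_antisymm (huniq _ _ h.choose_spec.1 h2) (huniq _ _ h1 h.choose_spec.2)
    have h4 : c z = !c (m h.choose z) := by
      change wellFounded_lt.fix _ z = _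
      rw [WellFounded.fix_eq, dif_pos h]
    rw [h4, h3]
  refine ⟨c, fun i x y hxy hE' b => ?_⟩
  have hz0 := hm i x
  obtain ⟨y', hy', hne⟩ : ∃ y', E i (m i x) y' ∧ m i x ≠ y' := by
    by_cases h : m i x = x
    · exact ⟨y, (hE i).trans ((hE i).symm hz0) hE', fun h' => hxy (h.symm.trans h')⟩
    · exact ⟨x, (hE i).symm hz0, h⟩
  -- At the stage where `y'` separates from the least element `m i x`, the least element of the new
  -- class of `y'` has just become least, so its colour is opposite to that of `m i x`.
  obtain ⟨j, hij, hj, hj'⟩ := hfirst i _ _ hne hy'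
  have h1 : m (j + 1) (m (j + 1) y') = m (j + 1) y' := (hcongr _ _ _ (hm _ _)).symm
  have hjz : E j y' (m (j + 1) y') := hanti _ _ _ _ le_self_add (hm _ _)
  have h2 : m j (m (j + 1) y') = m i x := by
    rw [← hcongr j _ _ ((hE j).trans hj hjz)]
    apply le_antisymm (hle _ _)
    exact hmin _ _ _ ((hE i).trans hz0 (hanti _ _ _ _ hij (hm _ _)))
  have h3 : m i x ≠ m (j + 1) y' := fun h => hj' (h ▸ (hE _).symm (hm (j + 1) y'))
  have h4 := hc _ j (by rw [h2]; exact h3) h1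
  rw [h2] at h4
  by_cases h5 : c (m i x) = b
  · exact ⟨_, hz0, h5⟩
  · refine ⟨_, (hE i).trans hz0 ((hE i).trans hy' (hanti _ _ _ _ hij hjz)), ?_⟩
    rw [h4]
    revert h5
    cases c (m i x) <;> cases b <;> simp

/-! ### Extensions of biworlds to countable depths -/

/-- Coherent families of nonempty sets have threads through each of their elements, at countable
limit depths. -/
theorem exists_thread {μ : Ordinal.{0}} (hμ : IsSuccLimit μ) (hc : (Set.Iio μ).Countable)
    (T : ∀ α : Ordinal.{0}, Set (Raw V Ag α)) (hT : ∀ α < μ, ∀ x ∈ T α, IsPrebiworld α x)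
    (hTr : ∀ α β (h : α ≤ β), β < μ → restr α β h '' T β = T α)
    {α : Ordinal.{0}} (hα : α < μ) {x : Raw V Ag α} (hx : x ∈ T α) :
    ∃ z : Raw V Ag μ, IsPrebiworld μ z ∧ restr α μ hα.le z = x ∧
      ∀ β (hβ : β < μ), restr β μ hβ.le z ∈ T β := by
  -- Running maxima of an enumeration of the ordinals below `μ` give a cofinal `ω`-sequence starting
  -- at `α`; lifting along it never meets a limit stage.
  obtain ⟨e, he⟩ := hc.exists_eq_range ⟨α, hα⟩
  have heμ : ∀ n, e n < μ := fun n => by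
    have : e n ∈ Set.Iio μ := he ▸ Set.mem_range_self n
    exact this
  let f : ℕ → Ordinal.{0} := fun n => Nat.rec α (fun n r => max r (e n)) n
  have f_succ : ∀ n, f (n + 1) = max (f n) (e n) := fun n => rfl
  have hfμ : ∀ n, f n < μ := by
    intro n
    induction n with
    | zero => exact hα
    | succ n ih => rw [f_succ]; exact max_lt ih (heμ n)
  have hmono : Monotone f := monotone_nat_of_le_succ fun n => by rw [f_succ]; exact le_max_left _ _
  have hcof : ∀ β < μ, ∃ n, β ≤ f n := by
    intro β hβ
    have : β ∈ Set.range e := he ▸ hβ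
    obtain ⟨n, rfl⟩ := this
    exact ⟨n + 1, by rw [f_succ]; exact le_max_right _ _⟩
  have hlift : ∀ n (p : T (f n)), ∃ q : T (f (n + 1)),
      restr (f n) (f (n + 1)) (hmono n.le_succ) q.1 = p.1 := by
    intro n p
    obtain ⟨q, hq, hq'⟩ : p.1 ∈ restr (f n) (f (n + 1)) (hmono n.le_succ) '' T (f (n + 1)) := by
      rw [hTr _ _ _ (hfμ (n + 1))]
      exact p.2
    exact ⟨⟨q, hq⟩, hq'⟩
  choose next hnext using hlift
  let g : ∀ n, T (f n) := fun n => Nat.rec (⟨x, hx⟩ : T (f 0)) next n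
  have hgp : ∀ n, IsPrebiworld _ (g n).1 := fun n => hT _ (hfμ n) _ (g n).2
  have hg : ∀ n m (h : n ≤ m), restr (f n) (f m) (hmono h) (g m).1 = (g n).1 := by
    intro n m h
    induction m, h using Nat.le_induction with
    | base => exact restr_self (hgp n)
    | succ m h ih =>
      rw [← restr_restr (hmono h) (hmono m.le_succ) (hgp (m + 1))]
      have : restr (f m) (f (m + 1)) (hmono m.le_succ) (g (m + 1)).1 = (g m).1 := hnext m (g m)
      rw [this, ih]
  choose k hk using hcof
  have hindep : ∀ β n m (hn : β ≤ f n) (hm : β ≤ f m),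
      restr β (f n) hn (g n).1 = restr β (f m) hm (g m).1 := by
    have : ∀ β n m (hn : β ≤ f n) (hm : β ≤ f m), n ≤ m →
        restr β (f n) hn (g n).1 = restr β (f m) hm (g m).1 := by
      intro β n m hn hm h
      rw [← hg n m h, restr_restr _ _ (hgp m)]
    intro β n m hn hm
    rcases le_total n m with h | h
    · exact this _ _ _ _ _ h
    · exact (this _ _ _ _ _ h).symm
  let z : Raw V Ag μ := (limitEquiv hμ).symm
    fun β => restr β.1 (f (k β.1 β.2)) (hk β.1 β.2) (g (k β.1 β.2)).1
  have hz : ∀ β (hβ : β < μ) n (hn : β ≤ f n), seq hμ z β hβ = restr β (f n) hn (g n).1 := by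
    intro β hβ n hn
    simp only [seq, z, Equiv.apply_symm_apply]
    exact hindep _ _ _ _ _
  have hzp : IsPrebiworld μ z := by
    rw [isPrebiworld_limit_iff hμ]
    refine ⟨fun β hβ => ?_, fun β hβ γ hγ hγβ => ⟨hγβ, ?_⟩⟩
    · rw [hz β hβ _ (hk β hβ)]
      exact isPrebiworld_restr _ (hgp _)
    · rw [hz β hβ _ (hk β hβ), hz γ hγ _ (hγβ.trans (hk β hβ)), restr_restr _ _ (hgp _)]
  refine ⟨z, hzp, ?_, fun β hβ => ?_⟩
  · rw [restr_limit hμ hzp hα, hz α hα 0 le_rfl]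
    exact restr_self (hgp 0)
  · rw [restr_limit hμ hzp hβ, hz β hβ _ (hk β hβ), ← hTr _ _ (hk β hβ) (hfμ _)]
    exact ⟨_, (g _).2, rfl⟩

theorem RegularUpTo.limit {μ : Ordinal.{0}} (hμ : IsSuccLimit μ) (hc : (Set.Iio μ).Countable)
    (H : ∀ ν < μ, RegularUpTo V Ag ν) : RegularUpTo V Ag μ := by
  intro α β h hβ
  rcases hβ.lt_or_eq with hlt | rfl
  · exact H β hlt α β h le_rfl
  rcases h.lt_or_eq with hα | rfl
  swap
  · exact Regular.refl _
  constructor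
  · intro w hw
    rw [restr_limit hμ hw.isPrebiworld hα]
    exact ((isBiworld_limit_iff hμ w).1 hw).2 α hα
  · intro x hx
    obtain ⟨z, hz, hzx, hzb⟩ := exists_thread hμ hc (fun α => {x : Raw V Ag α | IsBiworld α x})
      (fun _ _ _ h => IsBiworld.isPrebiworld h) (fun α γ h hγ => by
        ext y
        constructor
        · rintro ⟨w, hw, rfl⟩
          exact (H γ hγ α γ h le_rfl).1 w hw
        · intro hy
          obtain ⟨w, hw, rfl⟩ := (H γ hγ α γ h le_rfl).2 y hy
          exact ⟨w, hw, rfl⟩) hα hx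
    refine ⟨z, (isBiworld_limit_iff hμ z).2 ⟨hz, fun γ hγ => ?_⟩, hzx⟩
    rw [← restr_limit hμ hz hγ]
    exact hzb γ hγ

/-- A member of a side of a restriction of `y` extends to a world that stays on that side. -/
theorem exists_extension_on_side {μ : Ordinal.{0}} (H : RegularUpTo V Ag μ)
    (hc : (Set.Iio μ).Countable) {y : Raw V Ag μ} (hy : IsBiworld μ y) (s : Bool) (A : Ag)
    {α : Ordinal.{0}} (hα : α + 1 ≤ μ) {x : Raw V Ag α}
    (hx : x ∈ side s A (restr (α + 1) μ hα y)) :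
    ∃ z : Raw V Ag μ, IsBiworld μ z ∧ restr α μ (lt_of_add_one_le hα).le z = x ∧
      ∀ β (hβ : β + 1 ≤ μ), restr β μ (lt_of_add_one_le hβ).le z ∈
        side s A (restr (β + 1) μ hβ y) := by
  have hp := hy.isPrebiworld
  rcases zero_or_add_one_or_limit μ with rfl | ⟨ν, rfl⟩ | hμ
  · exact absurd hα not_add_one_le_zero
  · rw [side_restr_succ] at hx
    obtain ⟨w, hw, rfl⟩ := hx
    obtain ⟨z, hz, rfl⟩ := (H ν (ν + 1) le_self_add le_rfl).2 w (hy.of_mem_side hw)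
    refine ⟨z, hz, (restr_restr _ _ hz.isPrebiworld).symm, fun β hβ => ?_⟩
    rw [side_restr_succ]
    exact ⟨_, hw, restr_restr _ _ hz.isPrebiworld⟩
  · have hb : ∀ β (hβ : β + 1 ≤ μ), ∀ x ∈ side s A (restr (β + 1) μ hβ y), IsBiworld β x :=
      fun β hβ x hx => ((H _ _ hβ le_rfl).1 y hy).of_mem_side hx
    -- The thread runs through the sets `side s A (y|(β+1))`, which are coherent in `β`.
    obtain ⟨z, hz, hzx, hzb⟩ := exists_thread hμ hc
      (fun β => {x | ∃ hβ : β + 1 ≤ μ, x ∈ side s A (restr (β + 1) μ hβ y)})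
      (fun β _ x ⟨hβ, hx⟩ => (hb β hβ x hx).isPrebiworld) (fun β γ h hγ => by
        have hγ' : γ + 1 ≤ μ := by simpa using hγ
        have key := side_restr_add_one h hγ' hp s A
        ext w
        constructor
        · rintro ⟨w, ⟨_, hw⟩, rfl⟩
          refine ⟨(add_le_add_left h 1).trans hγ', ?_⟩
          rw [key]
          exact ⟨w, hw, rfl⟩
        · rintro ⟨_, hw⟩
          rw [key] at hw
          obtain ⟨w, hw, rfl⟩ := hw
          exact ⟨w, ⟨hγ', hw⟩, rfl⟩) (lt_of_add_one_le hα) ⟨hα, hx⟩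
    refine ⟨z, (isBiworld_limit_iff hμ z).2 ⟨hz, fun γ hγ => ?_⟩, hzx, fun β hβ => ?_⟩
    · rw [← restr_limit hμ hz hγ]
      obtain ⟨h1, h2⟩ := hzb γ hγ
      exact hb γ h1 _ h2
    · exact (hzb β (lt_of_add_one_le hβ)).2

-- One-step extensions with disjoint sides

/-- The worlds that are compatible with membership in a side of an extension of `y`. -/
def compatible {μ : Ordinal.{0}} (y : Raw V Ag μ) (A : Ag) (s : Bool) : Set (Raw V Ag μ) :=
  {z | IsBiworld μ z ∧ ∀ β (hβ : β + 1 ≤ μ), restr β μ (lt_of_add_one_le hβ).le z ∈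
        side s A (restr (β + 1) μ hβ y)}

/-- If `z` failed both sides, each at its own depth, it would fail both at the larger depth, where
its truncation must lie on some side. -/
theorem exists_mem_compatible {μ : Ordinal.{0}} (H : RegularUpTo V Ag μ) {y : Raw V Ag μ}
    (hy : IsBiworld μ y) (A : Ag) {z : Raw V Ag μ} (hz : IsBiworld μ z) :
    ∃ s, z ∈ compatible y A s := by
  by_contra! hcon
  have : ∀ s, ∃ β, ∃ hβ : β + 1 ≤ μ, restr β μ (lt_of_add_one_le hβ).le z ∉
        side s A (restr (β + 1) μ hβ y) := by
    intro s
    by_contra! h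
    exact hcon s ⟨hz, h⟩
  choose a ha hcon using this
  obtain ⟨m, hm, hm'⟩ : ∃ m, m + 1 ≤ μ ∧ ∀ t, a t ≤ m := by
    rcases le_total (a true) (a false) with h | h
    · exact ⟨a false, ha false, by rintro (_ | _) <;> simp [h]⟩
    · exact ⟨a true, ha true, by rintro (_ | _) <;> simp [h]⟩
  obtain ⟨t, ht⟩ := ((H _ _ hm le_rfl).1 y hy).exists_mem_side A
    ((H _ _ (lt_of_add_one_le hm).le le_rfl).1 z hz)
  apply hcon t
  rw [side_restr_add_one (hm' t) hm hy.isPrebiworld]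
  exact ⟨_, ht, restr_restr _ _ hz.isPrebiworld⟩

/-- The worlds compatible with both sides can be distributed over the sides in such a way that
each side has the right restrictions. -/
theorem exists_distribution {μ : Ordinal.{0}} (H : RegularUpTo V Ag μ)
    (hc : (Set.Iio μ).Countable) {y : Raw V Ag μ} (hy : IsBiworld μ y) (A : Ag) :
    ∃ color : Raw V Ag μ → Bool, ∀ s α (hα : α + 1 ≤ μ),
      ∀ x ∈ side s A (restr (α + 1) μ hα y), ∃ z ∈ compatible y A s,
        (z ∈ compatible y A (!s) → color z = s) ∧
        restr α μ (lt_of_add_one_le hα).le z = x := by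
  classical
  let S : Set (Raw V Ag μ) := {z | ∀ s, z ∈ compatible y A s}
  have hSp : ∀ z ∈ S, IsPrebiworld μ z := fun z hz => (hz true).1.isPrebiworld
  have memS : ∀ s z, z ∈ compatible y A s → z ∈ compatible y A (!s) → z ∈ S := by
    intro s z h1 h2 t
    cases s <;> cases t <;> assumption
  -- The chain is agreement of all truncations up to `α`; from `μ` on it is equality, so any ordinal
  -- index is allowed.
  obtain ⟨c, hcol⟩ := exists_splitting_coloring
    (fun α (z w : S) => ∀ β (h : β ≤ μ), β ≤ α → restr β μ h z.1 = restr β μ h w.1)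
    (fun α => ⟨fun _ _ _ _ => rfl, fun h β h1 h2 => (h β h1 h2).symm,
      fun h h' β h1 h2 => (h β h1 h2).trans (h' β h1 h2)⟩)
    (fun i j x y hij h β h1 h2 => h β h1 (h2.trans hij))
    (by
      intro i x y hne h
      rcases le_total i μ with hi | hi
      · obtain ⟨β, hβ, h1, h2, h3⟩ := exists_first_difference (hSp _ x.2) (hSp _ y.2)
          (fun h => hne (Subtype.ext h)) hi (h i hi le_rfl)
        refine ⟨β, h1, fun γ hγ hγβ => ?_, fun h4 => h3 (h4 _ hβ le_rfl)⟩
        rw [← restr_restr hγβ (lt_of_add_one_le hβ).le (hSp _ x.2), h2,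
          restr_restr _ _ (hSp _ y.2)]
      · exact absurd (by
          have := h μ le_rfl hi
          rwa [restr_self (hSp _ x.2), restr_self (hSp _ y.2), ← Subtype.ext_iff] at this) hne)
  -- Isolated points of `S` form singleton classes, which the colouring `c` cannot split.
  let iso : Raw V Ag μ → Prop := fun z => ∃ α, ∃ hα : α + 1 ≤ μ, ∀ w ∈ S,
    restr α μ (lt_of_add_one_le hα).le w = restr α μ (lt_of_add_one_le hα).le z → w = z
  -- Near `z`, side `true` has no world of its own outside `S`, so it needs `z`. Isolated points get
  -- colour `true` exactly in this case.
  let forced : Raw V Ag μ → Prop := fun z => ∃ α, ∃ hα : α + 1 ≤ μ, ∀ w ∈ compatible y A true,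
    restr α μ (lt_of_add_one_le hα).le w = restr α μ (lt_of_add_one_le hα).le z →
      w ∈ compatible y A false
  let color : Raw V Ag μ → Bool := fun z =>
    if iso z then decide (forced z) else if h : z ∈ S then c ⟨z, h⟩ else true
  refine ⟨color, fun s α hα x hx => ?_⟩
  obtain ⟨z, hzb, hzx, hz⟩ := exists_extension_on_side H hc hy s A hα hx
  have hzs : z ∈ compatible y A s := ⟨hzb, hz⟩
  by_contra! hcon
  have hcon' : ∀ w ∈ compatible y A s, restr α μ (lt_of_add_one_le hα).le w = x →
      w ∈ compatible y A (!s) ∧ color w ≠ s := by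
    intro w hw hwx
    by_contra h
    refine hcon w hw (fun h1 => ?_) hwx
    by_contra h2
    exact h ⟨h1, h2⟩
  have hzS : z ∈ S := memS s z hzs (hcon' z hzs hzx).1
  by_cases hiso : ∃ w ∈ S, restr α μ (lt_of_add_one_le hα).le w = x ∧ iso w
  · obtain ⟨w, hwS, hwx, hw⟩ := hiso
    have hcw := (hcon' w (hwS s) hwx).2
    simp only [color, if_pos hw] at hcw
    cases s with
    | true =>
      have hnf : ¬ forced w := by simpa using hcw
      apply hnf
      exact ⟨α, hα, fun u hu hux => (hcon' u hu (hux.trans hwx)).1⟩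
    | false =>
      have hf : forced w := by simpa using hcw
      obtain ⟨β, hβ, hf⟩ := hf
      obtain ⟨γ, hγ, hw⟩ := hw
      obtain ⟨δ, hδ, h1, h2, h3⟩ : ∃ δ, δ + 1 ≤ μ ∧ α ≤ δ ∧ β ≤ δ ∧ γ ≤ δ := by
        refine ⟨max α (max β γ), ?_, le_max_left _ _, (le_max_left _ _).trans (le_max_right _ _),
          (le_max_right _ _).trans (le_max_right _ _)⟩
        rcases max_choice α (max β γ) with h | h <;> rw [h]
        · exact hα
        · rcases max_choice β γ with h | h <;> rw [h] <;> assumption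
      -- Both sides cannot need `w`: its incompleted truncation to `δ` has another biworld `u` above
      -- it. Whichever side `u` is compatible with, it is then in `S`, against the isolation of `w`.
      have hI : Incompleted δ (restr δ μ (lt_of_add_one_le hδ).le w) :=
        ((H _ _ hδ le_rfl).1 y hy).incompleted (A := A) fun s => (hwS s).2 δ hδ
      obtain ⟨u, hu, huw, hur, -⟩ := exists_ne_of_incompleted H hδ w hI
      have hdown : ∀ ε (hε : ε ≤ δ), restr ε μ (hε.trans (lt_of_add_one_le hδ).le) u =
          restr ε μ (hε.trans (lt_of_add_one_le hδ).le) w := by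
        intro ε hε
        rw [← restr_restr hε (lt_of_add_one_le hδ).le hu.isPrebiworld, hur,
          restr_restr _ _ (hSp w hwS)]
      obtain ⟨t, ht⟩ := exists_mem_compatible H hy A hu
      have huS : u ∉ S := fun h => huw (hw u h (hdown γ h3))
      cases t with
      | true => exact huS (memS true u ht (hf u ht (hdown β h2)))
      | false => exact huS (memS false u ht (hcon' u ht ((hdown α h1).trans hwx)).1)
  -- With no isolated point over `x`, the class of `z` in `S` has a second member, so it contains a
  -- point of colour `s`.
  · have hziso : ¬ iso z := fun h => hiso ⟨z, hzS, hzx, h⟩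
    obtain ⟨w, hwS, hwz, hne⟩ : ∃ w ∈ S, restr α μ (lt_of_add_one_le hα).le w =
        restr α μ (lt_of_add_one_le hα).le z ∧ w ≠ z := by
      by_contra! h
      exact hziso ⟨α, hα, h⟩
    obtain ⟨u, hu, hus⟩ := hcol α ⟨z, hzS⟩ ⟨w, hwS⟩ (fun h => hne (Subtype.ext_iff.1 h).symm)
      (fun β h hβ => by
        change restr β μ h z = restr β μ h w
        rw [← restr_restr hβ (lt_of_add_one_le hα).le (hSp z hzS), ← hwz,
          restr_restr _ _ (hSp w hwS)]) s
    have hux : restr α μ (lt_of_add_one_le hα).le u.1 = x := by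
      rw [← hzx]; exact (hu α _ le_rfl).symm
    apply (hcon' u.1 (u.2 s) hux).2
    have : ¬ iso u.1 := fun h => hiso ⟨u, u.2, hux, h⟩
    simp only [color, if_neg this, dif_pos u.2]
    exact hus

/-- Every biworld extends to a biworld of the next depth whose sides are disjoint. -/
theorem exists_disjoint_extension {μ : Ordinal.{0}} (H : RegularUpTo V Ag μ)
    (hc : (Set.Iio μ).Countable) {y : Raw V Ag μ} (hy : IsBiworld μ y) :
    ∃ v : Raw V Ag (μ + 1), IsBiworld (μ + 1) v ∧ restr μ (μ + 1) le_self_add v = y ∧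
      ∀ A x, ¬ ∀ s, x ∈ side s A v := by
  choose color hcolor using exists_distribution H hc hy
  let v : Raw V Ag (μ + 1) := mkSides (obj μ y)
    fun s A => {z ∈ compatible y A s | z ∈ compatible y A (!s) → color A z = s}
  have hmem : ∀ s A z, z ∈ side s A v ↔ z ∈ compatible y A s ∧
      (z ∈ compatible y A (!s) → color A z = s) := by
    intro s A z
    simp only [v, side_mkSides]
    rfl
  have hdisj : ∀ A x, ¬ ∀ s, x ∈ side s A v := by
    intro A x h
    have h1 := (hmem _ _ _).1 (h true)
    have h2 := (hmem _ _ _).1 (h false)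
    have h3 := h1.2 h2.1
    rw [h2.2 h1.1] at h3
    exact Bool.false_ne_true h3
  have hv : IsBiworld (μ + 1) v := by
    rw [isBiworld_succ_iff_side]
    refine fun A => ⟨fun x => ⟨fun hx => ?_, fun ⟨s, hx⟩ => ((hmem _ _ _).1 hx).1.1⟩,
      fun x hx => absurd hx (hdisj A x)⟩
    obtain ⟨s, hs⟩ := exists_mem_compatible H hy A hx
    by_cases h : x ∈ compatible y A (!s)
    · refine ⟨color A x, (hmem _ _ _).2 ?_⟩
      cases s <;> cases color A x <;> simp_all
    · exact ⟨s, (hmem _ _ _).2 ⟨hs, fun h' => absurd h' h⟩⟩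
  refine ⟨v, hv, ?_, hdisj⟩
  apply restr_eq_of_sides hv.isPrebiworld hy.isPrebiworld (obj_mkSides _ _)
  intro α hα s A
  ext x
  constructor
  · rintro ⟨z, hz, rfl⟩
    exact ((hmem _ _ _).1 hz).1.2 α hα
  · intro hx
    obtain ⟨z, hz, hz', hzx⟩ := hcolor A s α hα x hx
    exact ⟨z, (hmem _ _ _).2 ⟨hz, hz'⟩, hzx⟩

/-- At a successor, biworlds restrict by `isBiworld_restr_succ` and extend by
`exists_disjoint_extension`, both resting on regularity below; at a limit, threads are used.
Countability enters through the threads. -/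
theorem regularUpTo_of_countable (μ : Ordinal.{0}) (hc : (Set.Iio μ).Countable) :
    RegularUpTo V Ag μ := by
  induction μ using limitRecOn with
  | zero =>
    intro α β h hβ
    obtain rfl : β = 0 := by simpa using hβ
    obtain rfl : α = 0 := by simpa using h
    exact Regular.refl 0
  | add_one μ ih =>
    have hc' : (Set.Iio μ).Countable := hc.mono (Set.Iio_subset_Iio le_self_add)
    have H := ih hc'
    have hstep : Regular V Ag (le_self_add : μ ≤ μ + 1) :=
      ⟨fun w hw => isBiworld_restr_succ H hw, fun x hx => by
        obtain ⟨v, hv, hvx, -⟩ := exists_disjoint_extension H hc' hx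
        exact ⟨v, hv, hvx⟩⟩
    intro α β h hβ
    rcases hβ.lt_or_eq with hlt | rfl
    · exact H α β h (by simpa using hlt)
    rcases h.lt_or_eq with hα | rfl
    · exact (H α μ (by simpa using hα) le_rfl).trans hstep
    · exact Regular.refl _
  | limit μ hμ ih =>
    exact RegularUpTo.limit hμ hc fun ν hν => ih ν hν (hc.mono (Set.Iio_subset_Iio hν.le))

-- Completed biworlds as those with disjoint sides

/-- Worlds with disjoint sides are completed. -/
theorem completed_of_disjoint {μ : Ordinal.{0}} {w : Raw V Ag (μ + 1)}
    (h : ∀ A x, ¬ ∀ s, x ∈ side s A w) : Completed (μ + 1) w := by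
  intro hw
  have hp : IsPrebiworld (μ + 1) w := ((incompleted_iff w).1 hw).1
  obtain ⟨A, z, -, hz⟩ := hw.exists_common
  apply h A (restr μ (μ + 1) le_self_add z)
  intro s
  have := hz μ le_rfl s
  rwa [restr_self hp] at this

/-- The sides of completed biworlds are disjoint. -/
theorem disjoint_of_completed {μ : Ordinal.{0}} (hc : (Set.Iio (μ + 1)).Countable)
    {w : Raw V Ag (μ + 1)} (hw : IsBiworld (μ + 1) w) (hw' : Completed (μ + 1) w) :
    ∀ A x, ¬ ∀ s, x ∈ side s A w := by
  classical
  intro A x hx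
  apply hw'
  obtain ⟨v, hv, rfl, hdisj⟩ :=
    exists_disjoint_extension (regularUpTo_of_countable (μ + 1) hc) hc hw
  have hp := hv.isPrebiworld
  have hx' : ∀ s, ∃ z ∈ side s A v, restr μ (μ + 1) le_self_add z = x := by
    intro s
    have := hx s
    rwa [← restr_self (isPrebiworld_restr _ hp), side_of_restr hp] at this
  choose z hz hzx using hx'
  -- The two worlds have the same restriction `x`, so exchanging them throughout `v` leaves its
  -- restriction unchanged. It does change `v`, because they lie on opposite, disjoint sides.
  let σ : Equiv.Perm (Raw V Ag (μ + 1)) := Equiv.swap (z true) (z false)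
  have hσσ : ∀ u, σ (σ u) = u := fun u => Equiv.swap_apply_self _ _ _
  have hσb : ∀ u, IsBiworld (μ + 1) u → IsBiworld (μ + 1) (σ u) := by
    intro u hu
    simp only [σ, Equiv.swap_apply_def]
    split_ifs
    · exact hv.of_mem_side (hz false)
    · exact hv.of_mem_side (hz true)
    · exact hu
  have hσr : ∀ u, restr μ (μ + 1) le_self_add (σ u) = restr μ (μ + 1) le_self_add u := by
    intro u
    simp only [σ, Equiv.swap_apply_def]
    split_ifs with h1 h2
    · rw [h1, hzx, hzx]
    · rw [h2, hzx, hzx]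
    · rfl
  let v' : Raw V Ag (μ + 1 + 1) := mkSides (obj _ v) fun s B => {u | σ u ∈ side s B v}
  have hmem : ∀ s B u, u ∈ side s B v' ↔ σ u ∈ side s B v := by
    intro s B u
    simp only [v', side_mkSides]
    rfl
  have hv' : IsBiworld (μ + 1 + 1) v' := by
    rw [isBiworld_succ_iff_side]
    refine fun B => ⟨fun u => ⟨fun hu => ?_, fun ⟨s, hu⟩ => ?_⟩, fun u hu => ?_⟩
    · obtain ⟨s, hs⟩ := hv.exists_mem_side B (hσb u hu)
      exact ⟨s, (hmem _ _ _).2 hs⟩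
    · rw [← hσσ u]
      exact hσb _ (hv.of_mem_side ((hmem _ _ _).1 hu))
    · exact absurd (fun s => (hmem _ _ _).1 (hu s)) (hdisj B (σ u))
  rw [incompleted_iff_restr]
  refine ⟨v, v', hv, hv', fun h => ?_, rfl, ?_⟩
  · have h1 : z true ∈ side true A v' := h ▸ hz true
    rw [hmem] at h1
    simp only [σ, Equiv.swap_apply_left] at h1
    exact hdisj A (z false) (by rintro (_ | _); exacts [hz false, h1])
  · apply ext_succ
    · rw [obj_restr _ hv'.isPrebiworld, obj_restr _ hp, obj_mkSides]
    · intro s B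
      rw [side_restr_succ, side_restr_succ]
      ext u
      constructor
      · rintro ⟨t, ht, rfl⟩
        exact ⟨σ t, (hmem _ _ _).1 ht, hσr t⟩
      · rintro ⟨t, ht, rfl⟩
        exact ⟨σ t, (hmem _ _ _).2 (by rwa [hσσ]), hσr t⟩

/-! ### Truth values -/

namespace TV

theorem leP_refl (a : TV) : leP a a := Or.inr rfl

theorem leP.eq {a b : TV} (h : leP a b) (ha : a ≠ uu) : a = b := h.resolve_left ha

theorem leP.inv {a b : TV} (h : leP a b) : leP a.inv b.inv := by
  rcases h with rfl | rfl
  · exact Or.inl rfl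
  · exact Or.inr rfl

theorem inv_ne_uu {a : TV} (h : a ≠ uu) : a.inv ≠ uu := by
  cases a <;> simp_all [TV.inv]

theorem glbT_eq_tt_iff (S : Set TV) : glbT S = tt ↔ ∀ a ∈ S, a = tt := by
  unfold glbT
  constructor
  · intro h a ha
    cases a
    · rfl
    · simp [ha] at h
    · split_ifs at h
  · intro h
    rw [if_neg fun h' => by simpa using h _ h', if_neg fun h' => by simpa using h _ h']

theorem glbT_eq_ff_iff (S : Set TV) : glbT S = ff ↔ ff ∈ S := by
  unfold glbT
  split_ifs <;> simp_all

theorem glbT_ne_uu {S : Set TV} (h : ∀ a ∈ S, a ≠ uu) : glbT S ≠ uu := by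
  unfold glbT
  split_ifs with h1 h2
  · simp
  · exact absurd rfl (h _ h2)
  · simp

/-- Both matching conditions are needed: `h'` transfers the value `tt`, which concerns all of `T`,
and `h` transfers `ff`, which needs a witness in `T`. -/
theorem leP_glbT {S T : Set TV} (h : ∀ a ∈ S, ∃ b ∈ T, leP a b) (h' : ∀ b ∈ T, ∃ a ∈ S, leP a b) :
    leP (glbT S) (glbT T) := by
  rcases hS : glbT S with _ | _ | _
  · right
    symm
    rw [glbT_eq_tt_iff] at hS ⊢
    intro b hb
    obtain ⟨a, ha, hab⟩ := h' b hb
    have := hS a ha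
    subst this
    exact (hab.eq (by simp)).symm
  · right
    symm
    rw [glbT_eq_ff_iff] at hS ⊢
    obtain ⟨b, hb, hab⟩ := h _ hS
    rwa [hab.eq (by simp)]
  · exact Or.inl rfl

theorem lubP_le_of_forall {S : Set TV} {a : TV} (h : ∀ b ∈ S, leP b a) : leP (lubP S) a := by
  refine (lubP_le_iff S ?_ a).2 h
  rintro ⟨h1, h2⟩
  have h3 := (h _ h1).eq (by simp)
  rw [← h3] at h
  exact absurd ((h _ h2).eq (by simp)) (by simp)

/-- Pairwise consistency rules out the sets containing both `tt` and `ff`, on which `lubP` has only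
a default value. -/
theorem le_lubP_of_consistent {S : Set TV} (h : ∀ a ∈ S, ∀ b ∈ S, leP a b ∨ leP b a) {a : TV}
    (ha : a ∈ S) : leP a (lubP S) := by
  refine (lubP_le_iff S ?_ _).1 (leP_refl _) a ha
  rintro ⟨h1, h2⟩
  rcases h _ h1 _ h2 with h | h <;> simp [leP] at h

end TV

/-! ### Monotonicity of the three-valued valuation -/

/-- The modal operators of the two sides. -/
def modal (s : Bool) (A : Ag) (φ : Formula V Ag) : Formula V Ag :=
  if s then .know A φ else .most A φ

/-- The identity or the inversion of truth values. -/
def twist (s : Bool) (a : TV) : TV := if s then a else a.inv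

theorem leP_twist (s : Bool) {a b : TV} (h : TV.leP a b) : TV.leP (twist s a) (twist s b) := by
  cases s
  · exact h.inv
  · exact h

theorem twist_ne_uu (s : Bool) {a : TV} (h : a ≠ TV.uu) : twist s a ≠ TV.uu := by
  cases s
  · exact TV.inv_ne_uu h
  · exact h

theorem val_modal_zero (s : Bool) (A : Ag) (φ : Formula V Ag) (w : Raw V Ag 0) :
    val (modal s A φ) 0 w = TV.uu := by
  cases s
  · exact val_most_zero A φ w
  · exact val_know_zero A φ w

theorem val_modal_succ (s : Bool) (A : Ag) (φ : Formula V Ag) {μ : Ordinal.{0}}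
    (w : Raw V Ag (μ + 1)) :
    val (modal s A φ) (μ + 1) w =
      TV.glbT {a | ∃ x ∈ side s A w, a = twist s (val φ μ x)} := by
  cases s
  · exact val_most_succ A φ w
  · exact val_know_succ A φ w

theorem val_modal_limit (s : Bool) (A : Ag) (φ : Formula V Ag) {μ : Ordinal.{0}}
    (hμ : IsSuccLimit μ) (w : Raw V Ag μ) :
    val (modal s A φ) μ w =
      TV.lubP {a | ∃ (α : Ordinal.{0}) (h : α < μ), a = val (modal s A φ) α (seq hμ w α h)} := by
  cases s
  · exact val_most_limit A φ hμ w
  · exact val_know_limit A φ hμ w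

/-- The value of `φ` in a prebiworld is at least as precise as in its restrictions. -/
def Monotonic (φ : Formula V Ag) : Prop :=
  ∀ (α μ : Ordinal.{0}) (h : α ≤ μ) (w : Raw V Ag μ), IsPrebiworld μ w →
    TV.leP (val φ α (restr α μ h w)) (val φ μ w)

/-- The outer induction on `μ` makes the values along a limit sequence a chain, so their `lubP` is a
genuine bound; the inner one on `α` handles restrictions of limit depth. -/
theorem Monotonic.modal {φ : Formula V Ag} (hφ : Monotonic φ) (s : Bool) (A : Ag) :
    Monotonic (modal s A φ) := by
  intro α μ
  revert α
  induction μ using WellFoundedLT.induction with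
  | ind μ ihμ =>
    intro α
    induction α using WellFoundedLT.induction with
    | ind α ihα =>
      intro h w hw
      rcases zero_or_add_one_or_limit α with rfl | ⟨α, rfl⟩ | hα
      · exact Or.inl (val_modal_zero _ _ _ _)
      · rcases zero_or_add_one_or_limit μ with rfl | ⟨μ, rfl⟩ | hμ
        · exact absurd h not_add_one_le_zero
        · have hw' := (isPrebiworld_succ_iff_side w).1 hw
          rw [val_modal_succ, val_modal_succ, side_restr_succ]
          apply TV.leP_glbT
          · rintro _ ⟨_, ⟨x, hx, rfl⟩, rfl⟩
            exact ⟨_, ⟨x, hx, rfl⟩, leP_twist s (hφ _ _ _ x (hw' s A x hx))⟩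
          · rintro _ ⟨x, hx, rfl⟩
            exact ⟨_, ⟨_, ⟨x, hx, rfl⟩, rfl⟩, leP_twist s (hφ _ _ _ x (hw' s A x hx))⟩
        · rw [val_modal_limit s A φ hμ w, restr_succ_limit hμ]
          have key : ∀ β (hβ : β < μ) γ (hγ : γ < μ), β ≤ γ →
              TV.leP (val (Biworlds.modal s A φ) β (seq hμ w β hβ))
                (val (Biworlds.modal s A φ) γ (seq hμ w γ hγ)) := by
            intro β hβ γ hγ h
            have := ihμ γ hγ β h _ (isPrebiworld_seq hμ hw γ hγ)
            rwa [restr_seq hμ hw] at this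
          apply TV.le_lubP_of_consistent
          · rintro _ ⟨β, hβ, rfl⟩ _ ⟨γ, hγ, rfl⟩
            rcases le_total β γ with h | h
            · exact Or.inl (key _ _ _ _ h)
            · exact Or.inr (key _ _ _ _ h)
          · exact ⟨_, _, rfl⟩
      · rw [val_modal_limit s A φ hα]
        apply TV.lubP_le_of_forall
        rintro _ ⟨β, hβ, rfl⟩
        rw [seq_restr_limit]
        exact ihα β hβ _ w hw

theorem Monotonic.every {φ : Formula V Ag} (hφ : Monotonic φ) (G : Set Ag) :
    Monotonic (.every G φ) := by
  intro α μ h w hw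
  rw [val_every, val_every]
  apply TV.leP_glbT
  · rintro _ ⟨A, hA, rfl⟩
    exact ⟨_, ⟨A, hA, rfl⟩, hφ.modal true A α μ h w hw⟩
  · rintro _ ⟨A, hA, rfl⟩
    exact ⟨_, ⟨A, hA, rfl⟩, hφ.modal true A α μ h w hw⟩

theorem Monotonic.everyIter {φ : Formula V Ag} (hφ : Monotonic φ) (G : Set Ag) (k : ℕ) :
    Monotonic (everyIter G φ k) := by
  induction k with
  | zero => exact hφ
  | succ k ih => exact ih.every G

theorem monotonic (φ : Formula V Ag) : Monotonic φ := by
  induction φ with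
  | atom p =>
    intro α μ h w hw
    right
    simp only [val]
    rw [obj_restr h hw]
  | and φ ψ hφ hψ =>
    intro α μ h w hw
    have h1 := hφ α μ h w hw
    have h2 := hψ α μ h w hw
    simp only [val]
    apply TV.leP_glbT
    · rintro _ (rfl | rfl)
      · exact ⟨_, Or.inl rfl, h1⟩
      · exact ⟨_, Or.inr rfl, h2⟩
    · rintro _ (rfl | rfl)
      · exact ⟨_, Or.inl rfl, h1⟩
      · exact ⟨_, Or.inr rfl, h2⟩
  | neg φ hφ => exact fun α μ h w hw => (hφ α μ h w hw).inv
  | know A φ hφ => exact hφ.modal true A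
  | most A φ hφ => exact hφ.modal false A
  | every G φ hφ => exact hφ.every G
  | common G φ hφ =>
    intro α μ h w hw
    rw [val_common, val_common]
    apply TV.leP_glbT
    · rintro _ ⟨k, hk, rfl⟩
      exact ⟨_, ⟨k, hk, rfl⟩, hφ.everyIter G k α μ h w hw⟩
    · rintro _ ⟨k, hk, rfl⟩
      exact ⟨_, ⟨k, hk, rfl⟩, hφ.everyIter G k α μ h w hw⟩

/-! ### Two-valuedness at depth `ω²` -/

/-- `φ` is true or false in all prebiworlds of depth at least `δ`. -/
def DecidedFrom (φ : Formula V Ag) (δ : Ordinal.{0}) : Prop :=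
  ∀ μ, δ ≤ μ → ∀ w : Raw V Ag μ, IsPrebiworld μ w → val φ μ w ≠ TV.uu

/-- At depth exactly `δ + 1` the bound runs over decided values of depth `δ`; monotonicity carries
the result to all greater depths, limits included. -/
theorem DecidedFrom.modal {φ : Formula V Ag} {δ : Ordinal.{0}} (h : DecidedFrom φ δ) (s : Bool)
    (A : Ag) : DecidedFrom (modal s A φ) (δ + 1) := by
  intro μ hμ w hw
  have h1 : val (Biworlds.modal s A φ) (δ + 1) (restr (δ + 1) μ hμ w) ≠ TV.uu := by
    rw [val_modal_succ]
    apply TV.glbT_ne_uu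
    rintro _ ⟨x, hx, rfl⟩
    exact twist_ne_uu s (h δ le_rfl x
      ((isPrebiworld_succ_iff_side _).1 (isPrebiworld_restr hμ hw) s A x hx))
  rwa [← (monotonic (Biworlds.modal s A φ) _ _ hμ w hw).eq h1]

theorem DecidedFrom.every {φ : Formula V Ag} {δ : Ordinal.{0}} (h : DecidedFrom φ δ)
    (G : Set Ag) : DecidedFrom (.every G φ) (δ + 1) := by
  intro μ hμ w hw
  rw [val_every]
  apply TV.glbT_ne_uu
  rintro _ ⟨A, hA, rfl⟩
  exact h.modal true A μ hμ w hw

theorem DecidedFrom.everyIter {φ : Formula V Ag} {δ : Ordinal.{0}} (h : DecidedFrom φ δ)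
    (G : Set Ag) (k : ℕ) : DecidedFrom (everyIter G φ k) (δ + k) := by
  induction k with
  | zero =>
    rw [Nat.cast_zero, add_zero]
    exact h
  | succ k ih =>
    rw [Nat.cast_succ, ← add_assoc]
    exact ih.every G

theorem DecidedFrom.common {φ : Formula V Ag} {δ : Ordinal.{0}} (h : DecidedFrom φ δ)
    (G : Set Ag) : DecidedFrom (.common G φ) (δ + ω) := by
  intro μ hμ w hw
  rw [val_common]
  apply TV.glbT_ne_uu
  rintro _ ⟨k, -, rfl⟩
  exact h.everyIter G k μ ((add_le_add_right (natCast_lt_omega0 k).le δ).trans hμ) w hw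

theorem add_lt_omegaSq {α β : Ordinal.{0}} (hα : α < omegaSq) (hβ : β < omegaSq) :
    α + β < omegaSq :=
  isPrincipal_add_omega0_opow _ hα hβ

theorem omega0_lt_omegaSq : ω < omegaSq := by
  conv_lhs => rw [← opow_one ω]
  exact (opow_lt_opow_iff_right one_lt_omega0).2 one_lt_two

theorem one_lt_omegaSq : 1 < omegaSq := one_lt_omega0.trans omega0_lt_omegaSq

/-- Nested `C_G` operators use up one `ω` each, so finite multiples of `ω` suffice for a formula,
and `ω²` for all formulas together. -/
theorem exists_decidedFrom (φ : Formula V Ag) : ∃ δ < omegaSq, DecidedFrom φ δ := by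
  induction φ with
  | atom p =>
    refine ⟨0, zero_lt_one.trans one_lt_omegaSq, fun μ _ w _ => ?_⟩
    simp only [val]
    split_ifs <;> simp
  | and φ ψ hφ hψ =>
    obtain ⟨δ, hδ, h⟩ := hφ
    obtain ⟨ε, hε, h'⟩ := hψ
    refine ⟨max δ ε, max_lt hδ hε, fun μ hμ w hw => ?_⟩
    simp only [val]
    apply TV.glbT_ne_uu
    rintro _ (rfl | rfl)
    · exact h μ ((le_max_left _ _).trans hμ) w hw
    · exact h' μ ((le_max_right _ _).trans hμ) w hw
  | neg φ hφ =>
    obtain ⟨δ, hδ, h⟩ := hφ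
    exact ⟨δ, hδ, fun μ hμ w hw => TV.inv_ne_uu (h μ hμ w hw)⟩
  | know A φ hφ =>
    obtain ⟨δ, hδ, h⟩ := hφ
    exact ⟨_, add_lt_omegaSq hδ one_lt_omegaSq, h.modal true A⟩
  | most A φ hφ =>
    obtain ⟨δ, hδ, h⟩ := hφ
    exact ⟨_, add_lt_omegaSq hδ one_lt_omegaSq, h.modal false A⟩
  | every G φ hφ =>
    obtain ⟨δ, hδ, h⟩ := hφ
    exact ⟨_, add_lt_omegaSq hδ one_lt_omegaSq, h.every G⟩
  | common G φ hφ =>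
    obtain ⟨δ, hδ, h⟩ := hφ
    exact ⟨_, add_lt_omegaSq hδ omega0_lt_omegaSq, h.common G⟩

theorem val_ne_uu (φ : Formula V Ag) {μ : Ordinal.{0}} (hμ : omegaSq ≤ μ) {w : Raw V Ag μ}
    (hw : IsPrebiworld μ w) : val φ μ w ≠ TV.uu := by
  obtain ⟨δ, hδ, h⟩ := exists_decidedFrom φ
  exact h μ (hδ.le.trans hμ) w hw

/-! ### The canonical Kripke structure -/

theorem countable_Iio_omegaSq_add_one : (Set.Iio (omegaSq + 1)).Countable := by
  have h : (Set.Iio omegaSq).Countable := by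
    rw [← Cardinal.le_aleph0_iff_set_countable, Cardinal.mk_Iio_ordinal]
    have : omegaSq.card ≤ Cardinal.aleph0 := by
      rw [omegaSq, ← one_add_one_eq_two, opow_add, opow_one, card_mul, card_omega0,
        Cardinal.aleph0_mul_aleph0]
    exact (Cardinal.lift_le.2 this).trans_eq Cardinal.lift_aleph0
  have h' : Set.Iio (omegaSq + 1) = insert omegaSq (Set.Iio omegaSq) := by
    ext x
    simp [le_iff_eq_or_lt]
  rw [h']
  exact h.insert _

theorem World.isPrebiworld (w : World V Ag) : IsPrebiworld (omegaSq + 1) w.1 :=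
  w.2.1.isPrebiworld

/-- The restriction of a world to depth `ω²`. -/
def World.base (w : World V Ag) : Raw V Ag omegaSq :=
  restr omegaSq (omegaSq + 1) le_self_add w.1

theorem World.isBiworld_base (w : World V Ag) : IsBiworld omegaSq w.base :=
  (regularUpTo_of_countable (omegaSq + 1) countable_Iio_omegaSq_add_one _ _ le_self_add le_rfl).1
    w.1 w.2.1

/-- A disjoint extension is completed, hence a world. -/
theorem exists_world {x : Raw V Ag omegaSq} (hx : IsBiworld omegaSq x) :
    ∃ w : World V Ag, w.base = x := by
  have hc : (Set.Iio omegaSq).Countable :=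
    countable_Iio_omegaSq_add_one.mono (Set.Iio_subset_Iio le_self_add)
  obtain ⟨v, hv, hvx, hdisj⟩ := exists_disjoint_extension (regularUpTo_of_countable _ hc) hc hx
  exact ⟨⟨v, hv, completed_of_disjoint hdisj⟩, hvx⟩

/-- The value at depth `ω²` is already two-valued, and a more precise value must then be equal to
it. -/
theorem World.val_base (w : World V Ag) (φ : Formula V Ag) :
    val φ omegaSq w.base = val φ (omegaSq + 1) w.1 :=
  (monotonic φ _ _ _ w.1 w.isPrebiworld).eq
    (val_ne_uu φ le_rfl w.isBiworld_base.isPrebiworld)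

/-- The worlds on a side of `w` are the restrictions of the worlds of the canonical structure. -/
theorem World.forall_side_iff (w : World V Ag) (s : Bool) (A : Ag)
    (p : Raw V Ag omegaSq → Prop) :
    (∀ x ∈ side s A w.1, p x) ↔ ∀ w' : World V Ag, w'.base ∈ side s A w.1 → p w'.base := by
  refine ⟨fun h w' hw' => h _ hw', fun h x hx => ?_⟩
  obtain ⟨w', rfl⟩ := exists_world (w.2.1.of_mem_side hx)
  exact h w' hx

/-- This is where the completedness of worlds matters: it excludes overlap, while the union
condition excludes gaps. Only the clause for `M_A` depends on it. -/
theorem World.mem_imposs_iff (w w' : World V Ag) (A : Ag) :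
    w'.base ∈ side false A w.1 ↔ w'.base ∉ side true A w.1 := by
  constructor
  · intro h h'
    exact disjoint_of_completed countable_Iio_omegaSq_add_one w.2.1 w.2.2 A w'.base
      (by rintro (_ | _) <;> assumption)
  · intro h
    obtain ⟨_ | _, hs⟩ := w.2.1.exists_mem_side A w'.isBiworld_base
    · exact hs
    · exact absurd hs h

theorem Kripke.sat_common_iff (K : Kripke V Ag) (G : Set Ag) (φ : Formula V Ag) (w : K.World) :
    K.Sat (.common G φ) w ↔ ∀ k : ℕ, 1 ≤ k → K.Sat (everyIter G φ k) w := by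
  constructor
  · intro h k hk
    obtain ⟨k, rfl⟩ := Nat.exists_eq_add_of_le' hk
    induction k generalizing w with
    | zero => exact fun A hA w' hw' => h w' (.single ⟨A, hA, hw'⟩)
    | succ k ih =>
      exact fun A hA w' hw' => ih w' (fun u hu => h u (.head ⟨A, hA, hw'⟩ hu)) (by omega)
  · intro h w' hw'
    induction hw' using Relation.TransGen.head_induction_on with
    | single hr =>
      obtain ⟨A, hA, hr⟩ := hr
      exact h 1 le_rfl A hA _ hr
    | head hr _ ih =>
      obtain ⟨A, hA, hr⟩ := hr
      exact ih fun k hk => h (k + 1) (by omega) A hA _ hr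

/-- The valuation of `φ` in worlds agrees with satisfaction in the canonical structure. -/
def Agrees (φ : Formula V Ag) : Prop :=
  ∀ w : World V Ag, val φ (omegaSq + 1) w.1 = TV.tt ↔ (canonical V Ag).Sat φ w

theorem Agrees.know {φ : Formula V Ag} (hφ : Agrees φ) (A : Ag) : Agrees (.know A φ) := by
  intro w
  rw [val_know_succ, TV.glbT_eq_tt_iff]
  have h1 := w.forall_side_iff true A fun x => val φ omegaSq x = TV.tt
  simp only [World.val_base, hφ _] at h1
  constructor
  · intro h
    exact h1.1 fun x hx => h _ ⟨x, hx, rfl⟩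
  · rintro h _ ⟨x, hx, rfl⟩
    exact h1.2 h x hx

theorem Agrees.most {φ : Formula V Ag} (hφ : Agrees φ) (A : Ag) : Agrees (.most A φ) := by
  intro w
  rw [val_most_succ, TV.glbT_eq_tt_iff]
  have h1 := w.forall_side_iff false A fun x => (val φ omegaSq x).inv = TV.tt
  have h2 : ∀ w' : World V Ag, (val φ (omegaSq + 1) w'.1).inv = TV.tt ↔
      ¬ (canonical V Ag).Sat φ w' := by
    intro w'
    rw [← hφ w']
    have := val_ne_uu φ le_self_add w'.isPrebiworld
    revert this
    cases val φ (omegaSq + 1) w'.1 <;> simp [TV.inv]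
  simp only [World.val_base, h2, World.mem_imposs_iff] at h1
  constructor
  · intro h w' hw'
    by_contra hcon
    exact h1.1 (fun x hx => h _ ⟨x, hx, rfl⟩) w' hcon hw'
  · rintro h _ ⟨x, hx, rfl⟩
    exact h1.2 (fun w' hw' hs => hw' (h w' hs)) x hx

theorem Agrees.every {φ : Formula V Ag} (hφ : Agrees φ) (G : Set Ag) : Agrees (.every G φ) := by
  intro w
  rw [val_every, TV.glbT_eq_tt_iff]
  constructor
  · intro h A hA
    exact (hφ.know A w).1 (h _ ⟨A, hA, rfl⟩)
  · rintro h _ ⟨A, hA, rfl⟩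
    exact (hφ.know A w).2 (h A hA)

theorem Agrees.everyIter {φ : Formula V Ag} (hφ : Agrees φ) (G : Set Ag) (k : ℕ) :
    Agrees (everyIter G φ k) := by
  induction k with
  | zero => exact hφ
  | succ k ih => exact ih.every G

theorem Agrees.common {φ : Formula V Ag} (hφ : Agrees φ) (G : Set Ag) :
    Agrees (.common G φ) := by
  intro w
  rw [val_common, TV.glbT_eq_tt_iff]
  refine Iff.trans ?_ ((canonical V Ag).sat_common_iff G φ w).symm
  constructor
  · exact fun h k hk => (hφ.everyIter G k w).1 (h _ ⟨k, hk, rfl⟩)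
  · rintro h _ ⟨k, hk, rfl⟩
    exact (hφ.everyIter G k w).2 (h k hk)

theorem agrees (φ : Formula V Ag) : Agrees φ := by
  induction φ with
  | atom p =>
    intro w
    simp [val, Kripke.Sat, canonical]
  | and φ ψ hφ hψ =>
    intro w
    simp [val, Kripke.Sat, TV.glbT_eq_tt_iff, hφ w, hψ w]
  | neg φ hφ =>
    intro w
    have := val_ne_uu φ le_self_add w.isPrebiworld
    have h := hφ w
    simp only [val, Kripke.Sat, ← h]
    revert this
    cases val φ (omegaSq + 1) w.1 <;> simp [TV.inv]
  | know A φ hφ => exact hφ.know A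
  | most A φ hφ => exact hφ.most A
  | every G φ hφ => exact hφ.every G
  | common G φ hφ => exact hφ.common G

end Biworlds

end

theorem theorem3 {V : Type*} {Ag : Type*} (φ : Biworlds.Formula V Ag) (w : Biworlds.World V Ag) :
    Biworlds.val φ (Biworlds.omegaSq + 1) w.1 = (Biworlds.canonical V Ag).val φ w := by
  have h := Biworlds.agrees φ w
  -- `Agrees` compares only the value true; since unknown cannot occur, the value false agrees as
  -- well.
  have h' := Biworlds.val_ne_uu φ le_self_add w.isPrebiworld
  unfold Biworlds.Kripke.val
  rw [← h]
  revert h'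
  cases Biworlds.val φ (Biworlds.omegaSq + 1) w.1 <;> simp
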